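/- Let $L,J$ be the numbers of service-requirement classes and received-power classes, and let $0<\rho\le 1$, $N_0,W>0$, received powers $P_j>0$ $(1\le j\le J)$, tolerable error probabilities $P_{e,l}\in(0,1)$ and message alphabet sizes $M_l\ge 1$ $(1\le l\le L)$ be given. A class-$(l,j)$ message has service requirement $S_l=-\ln P_{e,l}+\rho\ln M_l$ and received power $P_j$. Time is slotted; in each slot $A_{lj}$ messages of class $(l,j)$ arrive, where the numbers $A_{lj}$ are independent over the classes, i.i.d. over the slots, and have finite second moments. The state is the finite sequence $\alpha=((x_1,l_1,j_1),\dots,(x_n,l_n,j_n))$ of the messages in the system, $x_k>0$ being the residual service requirement. For $K\ge 1$, a non-idling policy $\omega\in\Omega_K$ chooses, deterministically or at random with a law that depends only on the current state, which messages transmit in the slot; exactly $\min(n,K)$ messages are chosen. If $s_{lj}$ is the number of chosen messages of class $(l,j)$, each chosen message of power class $j$ receives in this slot the service quantum $$\phi_j(s)=\rho\,\ln\Bigl(1+\frac{P_j}{(1+\rho)\,\bigl(N_0W+\sum_{l',j'}s_{l'j'}P_{j'}-P_j\bigr)}\Bigr),$$ which is subtracted from its residual requirement; a message leaves as soon as its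 requirement is met. Then the new messages join. This gives a Markov chain $\{X_n\}$ on the countable set $\mathcal X_K$ of those states in which every residual requirement of a class-$(l,j)$ message is a positive number of the form $S_l-\sum_i\phi_j(s^{(i)})$, a finite (possibly empty) sum over schedules $s^{(i)}$ of at most $K$ transmissions including at least one of power class $j$. (a) If $\sum_{l,j}\mathbb E A_{lj}\,S_l<\frac{\rho}{1+\rho}$, then there is $K_0$ such that for all $K\ge K_0$ and all $\omega\in\Omega_K$ the chain is positive recurrent and yields a finite stationary mean for the number of messages. That is: every essential state (a state that can be reached back from every state it leads to) has a finite mean return time, and from every state the set of essential states is entered in finite mean time; a stationary distribution exists, and under every stationary distribution the mean number of messages in the system is finite. (If the chain is irreducible, all states are essential, and this is positive recurrence in the usual sense.) (b) If $\sum_{l,j}\mathbb E A_{lj}\,S_l>\frac{\rho}{1+\rho}$, then there is $K_0$ such that for all $K\ge K_0$ and all $\omega\in\Omega_K$ every state from which infinitely many states can be reached is transient, i.e. with positive probability the chain never returns to it. In particular the chain is transient (all its states are transient) whenever infinitely many states can be reached from each state, for instance if it is irreducible on $\mathcal X_K$ with $LJ\geq 1$, or if some $A_{lj}$ has unbounded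 support. In both parts the threshold $\rho/(1+\rho)$ depends neither on the signal-to-noise ratios $P_j/(N_0W)$ nor, for given $\sum_{l,j}\mathbb E A_{lj}S_l$, on the distribution of the arrivals over the power classes (the fading distribution). -/

import Mathlib

open Filter MeasureTheory
open scoped ENNReal

noncomputable section

/-! ### Markov chains with a countable set of successors, given by transition probabilities -/

namespace Chain

variable {E : Type*}

/-- `avoid P A n x` is `Pr_x (X_1 ∉ A, …, X_n ∉ A) = Pr_x (τ_A > n)` for the chain with transition
probabilities `P` started at `x`, where `τ_A = min {n ≥ 1 : X_n ∈ A}`. -/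
def avoid (P : E → PMF E) (A : Set E) : ℕ → E → ℝ≥0∞
  | 0, _ => 1
  | n + 1, x => ∑' y, P x y * Aᶜ.indicator (avoid P A n) y

/-- The mean `E_x [τ_A] = ∑ₙ Pr_x (τ_A > n)` of the first time `τ_A ≥ 1` at which `A` is entered. -/
def meanEntryTime (P : E → PMF E) (A : Set E) (x : E) : ℝ≥0∞ :=
  ∑' n, avoid P A n x

/-- `y` can be reached from `x` in zero or more steps. -/
def Reaches (P : E → PMF E) (x y : E) : Prop :=
  Relation.ReflTransGen (fun u v => v ∈ (P u).support) x y

/-- `x` can be reached from every state to which it leads. If the chain is irreducible, all states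
are essential. -/
def IsEssential (P : E → PMF E) (x : E) : Prop :=
  ∀ y, Reaches P x y → Reaches P y x

/-- The state `x` is transient: with positive probability the chain never returns to `x`. -/
def IsTransientState (P : E → PMF E) (x : E) : Prop :=
  0 < ⨅ n, avoid P {x} n x

/-- Positive recurrence of the chain on a state space `X`: every essential state has a finite mean
return time, and from every state the essential states are entered in finite mean time. For an
irreducible chain this says that every state has a finite mean return time. -/
def IsPositiveRecurrent (P : E → PMF E) (X : Set E) : Prop :=
  (∀ x ∈ X, IsEssential P x → meanEntryTime P {x} x < ∞) ∧
  (∀ x ∈ X, meanEntryTime P {y | y ∈ X ∧ IsEssential P y} x < ∞)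

/-- `π` is a stationary distribution of the chain on `X`. -/
def IsStationary (P : E → PMF E) (X : Set E) (π : PMF E) : Prop :=
  π.support ⊆ X ∧ π.bind P = π

end Chain

/-! ### The random-coded multiple-access system -/

/-- The parameters of the system, with `L` service requirement classes and `J` received power
classes. `errProb l` and `alphabet l` are the tolerable error probability and the size of the
message alphabet, `power j` is the received power, `arr l j` the law of the number of class-`(l, j)`
messages that arrive in a slot. -/
structure RCSystem (L J : ℕ) where
  rho : ℝ
  rho_pos : 0 < rho
  rho_le_one : rho ≤ 1
  N0 : ℝ
  N0_pos : 0 < N0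
  W : ℝ
  W_pos : 0 < W
  errProb : Fin L → ℝ
  errProb_pos : ∀ l, 0 < errProb l
  errProb_lt_one : ∀ l, errProb l < 1
  alphabet : Fin L → ℕ
  alphabet_pos : ∀ l, 1 ≤ alphabet l
  power : Fin J → ℝ
  power_pos : ∀ j, 0 < power j
  arr : Fin L → Fin J → PMF ℕ
  secondMoment_finite : ∀ l j, ∑' k : ℕ, (k : ℝ≥0∞) ^ 2 * arr l j k < ∞

/-- A message in the system: residual service requirement, service requirement class and received
power class. -/
structure RCMessage (L J : ℕ) where
  residual : ℝ
  req : Fin L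
  pow : Fin J

/-- A state is the finite sequence of the messages in the system. -/
abbrev RCState (L J : ℕ) := List (RCMessage L J)

/-- A schedule: `s l j` messages of class `(l, j)` transmit. -/
abbrev RCSchedule (L J : ℕ) := Fin L → Fin J → ℕ

namespace RCSystem

variable {L J : ℕ} (sys : RCSystem L J)

/-- The service requirement `S_l = - ln P_{e,l} + ρ ln M_l`. -/
def serviceReq (l : Fin L) : ℝ :=
  -Real.log (sys.errProb l) + sys.rho * Real.log (sys.alphabet l)

/-- The mean number of class-`(l, j)` arrivals in a slot. -/
def meanArr (l : Fin L) (j : Fin J) : ℝ :=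
  ∑' k : ℕ, (k : ℝ) * (sys.arr l j k).toReal

/-- The effective noise variance seen by a transmission of power class `j` under the schedule `s`:
thermal noise plus the powers of all other transmissions. -/
def noise (s : RCSchedule L J) (j : Fin J) : ℝ :=
  sys.N0 * sys.W + ((∑ l, ∑ i, (s l i : ℝ) * sys.power i) - sys.power j)

/-- The service quantum `φ_j(s)` that each scheduled message of power class `j` receives in a slot
under the schedule `s`. -/
def quantum (s : RCSchedule L J) (j : Fin J) : ℝ :=
  if 0 < ∑ l, s l j then
    sys.rho * Real.log (1 + sys.power j / ((1 + sys.rho) * sys.noise s j))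
  else 0

/-- The residual service requirements that a message of class `(l, j)` can have: what remains, and
is positive, after finitely many (possibly zero) slots of service under schedules of at most `K`
transmissions. -/
inductive IsResidual (K : ℕ) (l : Fin L) (j : Fin J) : ℝ → Prop
  | fresh : IsResidual K l j (sys.serviceReq l)
  | serve (x : ℝ) (s : RCSchedule L J) : IsResidual K l j x →
      ∑ l', ∑ j', s l' j' ≤ K → 0 < ∑ l', s l' j → 0 < x - sys.quantum s j →
      IsResidual K l j (x - sys.quantum s j)

/-- The (countable) state space of the system with at most `K` simultaneous transmissions. -/
def stateSpace (K : ℕ) : Set (RCState L J) :=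
  {α | ∀ m ∈ α, sys.IsResidual K m.req m.pow m.residual}

/-- The schedule that is in force when the messages at the positions in `T` transmit. -/
def scheduleOf (α : RCState L J) (T : Finset (Fin α.length)) : RCSchedule L J :=
  fun l j => (T.filter fun k => (α.get k).req = l ∧ (α.get k).pow = j).card

/-- The messages left in the system after a slot in which the messages at the positions in `T`
transmit. A message leaves once its service requirement has been met. -/
def afterService (α : RCState L J) (T : Finset (Fin α.length)) : RCState L J :=
  (List.finRange α.length).filterMap fun k =>
    if k ∈ T then
      if (α.get k).residual ≤ sys.quantum (scheduleOf α T) (α.get k).pow then none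
      else some ⟨(α.get k).residual - sys.quantum (scheduleOf α T) (α.get k).pow,
        (α.get k).req, (α.get k).pow⟩
    else some (α.get k)

/-- The joint law of the independent numbers of arrivals of all classes in a slot. -/
def arrivalLaw : PMF (Fin L × Fin J → ℕ) :=
  (Measure.pi fun c : Fin L × Fin J => (sys.arr c.1 c.2).toMeasure).toPMF

/-- The newly arrived messages, `a (l, j)` of each class `(l, j)`. -/
def batch (a : Fin L × Fin J → ℕ) : RCState L J :=
  (List.finRange L).flatMap fun l => (List.finRange J).flatMap fun j =>
    List.replicate (a (l, j)) ⟨sys.serviceReq l, l, j⟩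

end RCSystem

/-- A (deterministic or random) non-idling scheduling policy with at most `K` simultaneous
transmissions: for each state, the law of the set of messages that transmit. As many messages as
possible, up to `K`, are always scheduled. -/
structure RCPolicy (L J K : ℕ) where
  choose : (α : RCState L J) → PMF (Finset (Fin α.length))
  nonIdling : ∀ α, ∀ T ∈ (choose α).support, T.card = min α.length K

/-- The transition probabilities of the Markov chain of the system under the policy `ω`: in a slot,
the scheduled messages are served and then the new messages join. -/
def RCSystem.step {L J K : ℕ} (sys : RCSystem L J) (ω : RCPolicy L J K) (α : RCState L J) :
    PMF (RCState L J) :=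
  (ω.choose α).bind fun T => sys.arrivalLaw.map fun a => sys.afterService α T ++ sys.batch a

end

/-! When many messages transmit, each one is a small part of the total power, so the logarithm in
its quantum is close to its argument. If `x` is the total transmitted power and `q` bounds the
individual powers, the total service lies between `ρ/(1+ρ) · x/(N₀W + x)` and `ρ/(1+ρ) · x/(x - q)`.
Both tend to `ρ/(1+ρ)`, uniformly in the choice of the `K` messages. Once `K` messages are present,
the system is thus nearly a single server that removes work at rate `ρ/(1+ρ)`, under every
non-idling policy (`eventually_le_sum_quantum`, `eventually_sum_quantum_le`).

Stability: work is wasted only in the last quantum of a departing message, and quanta are at most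
`ε` for large `K`. Counting `residual + ε` per message absorbs this waste, and the square of the
total is a Lyapunov function whose drift is linearly negative in the number of messages. Only
finitely many states have a given length, so Foster's criterion `Chain.positiveRecurrent_of_drift`
applies and also bounds the stationary mean.

Instability: a slot removes at most its total service from the true work `U`, so `exp (-θ U)` is
superharmonic on states with at least `K` messages if `θ` is small. Infinitely many reachable states
include some with large `U`, which gives transience by `Chain.isTransientState_of_superharmonic`. -/

namespace Chain

variable {E F : Type*}

/-! ### Means under transition laws and closed sets -/

/-- The mean of an extended nonnegative function under a probability mass function. -/
noncomputable def mean (p : PMF E) (f : E → ℝ≥0∞) : ℝ≥0∞ := ∑' y, p y * f y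

theorem mean_mono {p : PMF E} {f g : E → ℝ≥0∞} (h : ∀ y ∈ p.support, f y ≤ g y) :
    mean p f ≤ mean p g := by
  refine ENNReal.tsum_le_tsum fun y => ?_
  by_cases hy : y ∈ p.support
  · gcongr
    exact h y hy
  · simp [(PMF.apply_eq_zero_iff p y).2 hy]

@[simp] theorem mean_const (p : PMF E) (c : ℝ≥0∞) : mean p (fun _ => c) = c := by
  simp [mean, ENNReal.tsum_mul_right, p.tsum_coe]

theorem mean_add (p : PMF E) (f g : E → ℝ≥0∞) :
    mean p (fun y => f y + g y) = mean p f + mean p g := by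
  simp [mean, mul_add, ENNReal.tsum_add]

theorem mean_const_mul (p : PMF E) (c : ℝ≥0∞) (f : E → ℝ≥0∞) :
    mean p (fun y => c * f y) = c * mean p f := by
  simp only [mean, ← ENNReal.tsum_mul_left]
  exact tsum_congr fun y => by ring

theorem mean_finset_sum {ι : Type*} (p : PMF E) (s : Finset ι) (f : ι → E → ℝ≥0∞) :
    mean p (fun y => ∑ i ∈ s, f i y) = ∑ i ∈ s, mean p (f i) := by
  simp only [mean, Finset.mul_sum]
  exact Summable.tsum_finsetSum fun _ _ => ENNReal.summable

theorem mean_bind (p : PMF E) (k : E → PMF F) (f : F → ℝ≥0∞) :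
    mean (p.bind k) f = mean p fun x => mean (k x) f := by
  simp only [mean, PMF.bind_apply, ← ENNReal.tsum_mul_right, ← ENNReal.tsum_mul_left]
  rw [ENNReal.tsum_comm]
  exact tsum_congr fun _ => tsum_congr fun _ => by ring

theorem mean_pure (x : E) (f : E → ℝ≥0∞) : mean (PMF.pure x) f = f x := by
  rw [mean, tsum_eq_single x]
  · simp
  · intro y hy
    simp [hy]

theorem mean_map (p : PMF E) (k : E → F) (f : F → ℝ≥0∞) :
    mean (p.map k) f = mean p fun x => f (k x) := by
  rw [PMF.map, mean_bind]
  simp only [Function.comp_apply, mean_pure]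

theorem mul_le_mean (p : PMF E) (f : E → ℝ≥0∞) (y : E) : p y * f y ≤ mean p f :=
  ENNReal.le_tsum y

/-- `X` is closed: the chain does not leave it. -/
def IsClosedSet (P : E → PMF E) (X : Set E) : Prop :=
  ∀ x ∈ X, ∀ y ∈ (P x).support, y ∈ X

theorem IsClosedSet.reaches {P : E → PMF E} {X : Set E} (hX : IsClosedSet P X) {x y : E}
    (hx : x ∈ X) (h : Reaches P x y) : y ∈ X := by
  induction h with
  | refl => exact hx
  | tail _ h ih => exact hX _ ih _ h

theorem isClosedSet_reaches (P : E → PMF E) (x : E) : IsClosedSet P {y | Reaches P x y} :=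
  fun _ hy _ hz => Relation.ReflTransGen.tail hy hz

/-! ### Mean entry times and essential states -/

section EntryTimes

variable (P : E → PMF E) (A : Set E)

/-- The truncated mean entry time `E_x [min τ_A n]`. -/
noncomputable def truncEntryTime (n : ℕ) (x : E) : ℝ≥0∞ := ∑ k ∈ Finset.range n, avoid P A k x

theorem avoid_succ (n : ℕ) (x : E) :
    avoid P A (n + 1) x = mean (P x) (Aᶜ.indicator (avoid P A n)) := rfl

theorem avoid_le_one (n : ℕ) (x : E) : avoid P A n x ≤ 1 := by
  induction n generalizing x with
  | zero => exact le_rfl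
  | succ n ih =>
    rw [avoid_succ]
    refine (mean_mono (g := fun _ => 1) fun y _ => ?_).trans (mean_const _ _).le
    exact (Set.indicator_le_self _ _ _).trans (ih y)

theorem truncEntryTime_succ (n : ℕ) (x : E) :
    truncEntryTime P A (n + 1) x = 1 + mean (P x) (Aᶜ.indicator (truncEntryTime P A n)) := by
  induction n with
  | zero =>
    have : (Aᶜ.indicator (truncEntryTime P A 0)) = fun _ => 0 := by
      ext y
      simp [truncEntryTime, Set.indicator]
    rw [this]
    simp [truncEntryTime, avoid]
  | succ n ih =>
    rw [truncEntryTime, Finset.sum_range_succ, ← truncEntryTime, ih, avoid_succ, add_assoc,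
      ← mean_add]
    congr 2
    ext y
    by_cases hy : y ∈ Aᶜ
    · simp [Set.indicator_of_mem hy, truncEntryTime, Finset.sum_range_succ]
    · simp [Set.indicator_of_notMem hy]

theorem truncEntryTime_mono {m n : ℕ} (h : m ≤ n) (x : E) :
    truncEntryTime P A m x ≤ truncEntryTime P A n x :=
  Finset.sum_le_sum_of_subset (Finset.range_subset_range.2 h)

theorem truncEntryTime_ne_top (n : ℕ) (x : E) : truncEntryTime P A n x ≠ ∞ :=
  ENNReal.sum_ne_top.2 fun k _ => ((avoid_le_one P A k x).trans_lt ENNReal.one_lt_top).ne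

theorem meanEntryTime_le {x : E} {c : ℝ≥0∞} (h : ∀ n, truncEntryTime P A n x ≤ c) :
    meanEntryTime P A x ≤ c :=
  le_of_tendsto' (ENNReal.tendsto_nat_tsum _) h

variable {P A}

/-- Up to the first entrance into `C` the truncated entry time is dominated by a Lyapunov function
with drift at most `-1` off `C`. -/
theorem indicator_truncEntryTime_le {X C : Set E} (hX : IsClosedSet P X) {h : E → ℝ≥0∞}
    (hdrift : ∀ x ∈ X, x ∉ C → mean (P x) h + 1 ≤ h x) {M : ℝ≥0∞} {N : ℕ}
    (hM : ∀ c ∈ X ∩ C, Aᶜ.indicator (truncEntryTime P A N) c ≤ M) {n : ℕ} (hn : n ≤ N)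
    {x : E} (hx : x ∈ X) : Aᶜ.indicator (truncEntryTime P A n) x ≤ h x + M := by
  induction n generalizing x with
  | zero => simp [truncEntryTime, Set.indicator]
  | succ n ih =>
    by_cases hC : x ∈ C
    · refine le_trans ?_ ((hM x ⟨hx, hC⟩).trans le_add_self)
      exact Set.indicator_le_indicator (truncEntryTime_mono P A hn x)
    · refine (Set.indicator_le_self _ _ _).trans ?_
      rw [truncEntryTime_succ]
      calc 1 + mean (P x) (Aᶜ.indicator (truncEntryTime P A n))
          ≤ 1 + mean (P x) (fun y => h y + M) := by
            gcongr
            exact mean_mono fun y hy => ih (by omega) (hX x hx y hy)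
        _ = (mean (P x) h + 1) + M := by rw [mean_add, mean_const]; ring
        _ ≤ h x + M := by gcongr; exact hdrift x hx hC

/-- If a finite set `C` is entered in finite mean time, as witnessed by a Lyapunov function, and `A`
can be reached from each point of `C`, then `A` is entered in finite mean time. -/
theorem meanEntryTime_lt_top {X C : Set E} (hX : IsClosedSet P X) (hC : (X ∩ C).Finite)
    {h : E → ℝ≥0∞} (hP : ∀ x ∈ X, mean (P x) h ≠ ∞)
    (hdrift : ∀ x ∈ X, x ∉ C → mean (P x) h + 1 ≤ h x)
    (hreach : ∀ c ∈ X ∩ C, ∃ a ∈ A, Reaches P c a) {x : E} (hx : x ∈ X) :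
    meanEntryTime P A x < ∞ := by
  classical
  -- Truncation at `n` keeps `g n` and its maximum `M n` over the finite set finite, so they may be
  -- cancelled; the task is a bound on `M n` uniform in `n`.
  set g : ℕ → E → ℝ≥0∞ := fun n => Aᶜ.indicator (truncEntryTime P A n) with hg
  set M : ℕ → ℝ≥0∞ := fun n => hC.toFinset.sup (g n) with hMdef
  have hgtop : ∀ n y, g n y ≠ ∞ := fun n y =>
    ((Set.indicator_le_self _ _ _).trans_lt (truncEntryTime_ne_top P A n y).lt_top).ne
  have hMtop : ∀ n, M n ≠ ∞ := fun n => by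
    refine ((Finset.sup_lt_iff ENNReal.zero_lt_top).2 fun y _ => (hgtop n y).lt_top).ne
  have hgM : ∀ n, ∀ c ∈ X ∩ C, g n c ≤ M n := fun n c hc =>
    Finset.le_sup (f := g n) (hC.mem_toFinset.2 hc)
  have hgh : ∀ n, ∀ y ∈ X, g n y ≤ h y + M n := fun n y hy =>
    indicator_truncEntryTime_le hX hdrift (hgM n) le_rfl hy
  have hstep : ∀ n, ∀ y, g n y ≤ 1 + mean (P y) (g n) := fun n y => by
    refine (Set.indicator_le_self _ _ _).trans
      ((truncEntryTime_mono P A n.le_succ y).trans ?_)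
    rw [truncEntryTime_succ]
  -- Along a path to `a`, the bound `M n` is saved with a positive probability `p`, at a cost `k`
  -- that does not depend on `n`. At the point of `C` where `g n` equals `M n`, this reads `p * M n
  -- ≤ k`.
  have hpath : ∀ y a, a ∈ A → Reaches P y a → y ∈ X →
      ∃ k p : ℝ≥0∞, k ≠ ∞ ∧ p ≠ 0 ∧ ∀ n, g n y + p * M n ≤ k + M n := by
    intro y a ha hya
    induction hya using Relation.ReflTransGen.head_induction_on with
    | refl =>
      intro _
      refine ⟨0, 1, by simp, by simp, fun n => ?_⟩
      have : g n a = 0 := Set.indicator_of_notMem (by simpa using ha) _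
      simp [this]
    | @head y z hyz _ ih =>
      intro hy
      obtain ⟨k, p, hk, hp, hkp⟩ := ih (hX y hy z hyz)
      refine ⟨1 + P y z * k + mean (P y) h, P y z * p, ?_, mul_ne_zero hyz hp, fun n => ?_⟩
      · exact ENNReal.add_ne_top.2 ⟨ENNReal.add_ne_top.2
          ⟨ENNReal.one_ne_top, ENNReal.mul_ne_top (PMF.apply_ne_top _ _) hk⟩, hP y hy⟩
      have key : mean (P y) (g n) + P y z * p * M n
          ≤ P y z * k + mean (P y) h + M n := by
        have e1 : P y z * p * M n = mean (P y) (fun w => if w = z then p * M n else 0) := by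
          rw [mean, tsum_eq_single z]
          · simp [mul_assoc]
          · intro w hw
            simp [hw]
        have e2 : P y z * k = mean (P y) (fun w => if w = z then k else 0) := by
          rw [mean, tsum_eq_single z]
          · simp
          · intro w hw
            simp [hw]
        rw [e1, e2, ← mean_add, ← mean_add, ← mean_const (P y) (M n), ← mean_add]
        refine mean_mono fun w hw => ?_
        rw [mean_const]
        by_cases hwz : w = z
        · subst hwz
          simp only [if_true]
          refine (hkp n).trans ?_
          rw [add_right_comm]
          exact le_self_add
        · simp only [hwz, if_false, add_zero, zero_add]
          exact hgh n w (hX y hy w hw)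
      calc g n y + P y z * p * M n ≤ 1 + mean (P y) (g n) + P y z * p * M n := by
            gcongr; exact hstep n y
        _ = 1 + (mean (P y) (g n) + P y z * p * M n) := by ring
        _ ≤ 1 + (P y z * k + mean (P y) h + M n) := by gcongr
        _ = _ := by ring
  have hbound : ∃ B : ℝ≥0∞, B ≠ ∞ ∧ ∀ n, M n ≤ B := by
    have : ∀ c ∈ hC.toFinset, ∃ b : ℝ≥0∞, b ≠ ∞ ∧ ∀ n, g n c = M n → M n ≤ b := by
      intro c hc
      have hc := hC.mem_toFinset.1 hc
      obtain ⟨a, ha, hca⟩ := hreach c hc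
      obtain ⟨k, p, hk, hp, hkp⟩ := hpath c a ha hca hc.1
      refine ⟨k / p, ENNReal.div_ne_top hk hp, fun n hn => ?_⟩
      have h1 := hkp n
      rw [hn, add_comm (M n), ENNReal.add_le_add_iff_right (hMtop n)] at h1
      have hptop : p = ∞ ∨ p ≠ ∞ := em _
      rcases hptop with rfl | hptop
      · have : M n = 0 := by
          by_contra h0
          rw [ENNReal.top_mul h0] at h1
          exact hk (top_le_iff.1 h1)
        simp [this]
      · rw [ENNReal.le_div_iff_mul_le (Or.inl hp) (Or.inl hptop), mul_comm]
        exact h1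
    choose! b hb hbM using this
    refine ⟨∑ c ∈ hC.toFinset, b c, ENNReal.sum_ne_top.2 hb, fun n => ?_⟩
    rcases hC.toFinset.eq_empty_or_nonempty with h0 | h0
    · simp [hMdef, h0]
    · obtain ⟨c, hc, hcM⟩ := Finset.exists_mem_eq_sup hC.toFinset h0 (g n)
      exact (hbM c hc n hcM.symm).trans (Finset.single_le_sum (fun _ _ => zero_le) hc)
  obtain ⟨B, hB, hMB⟩ := hbound
  refine (meanEntryTime_le P A (c := 1 + (mean (P x) h + B)) fun n => ?_).trans_lt ?_
  · refine (truncEntryTime_mono P A n.le_succ x).trans ?_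
    rw [truncEntryTime_succ, ← mean_const (P x) B, ← mean_add]
    gcongr
    exact mean_mono fun y hy => (hgh n y (hX x hx y hy)).trans (by gcongr; exact hMB n)
  · exact (ENNReal.add_ne_top.2 ⟨ENNReal.one_ne_top, ENNReal.add_ne_top.2 ⟨hP x hx, hB⟩⟩).lt_top

/-- If a Lyapunov function has drift at most `-1` off `C`, every state leads to `C`. -/
theorem exists_reaches {X C : Set E} (hX : IsClosedSet P X)
    {h : E → ℝ≥0∞} (hh : ∀ x ∈ X, h x ≠ ∞)
    (hdrift : ∀ x ∈ X, x ∉ C → mean (P x) h + 1 ≤ h x) {x : E} (hx : x ∈ X) :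
    ∃ c ∈ C, Reaches P x c := by
  by_contra! hcon
  -- If `C` is never met, the drift condition holds on all states reachable from `x`, and each use
  -- of it raises the lower bound on `h` by one.
  have key : ∀ n : ℕ, ∀ y, Reaches P x y → (n : ℝ≥0∞) ≤ h y := by
    intro n
    induction n with
    | zero => simp
    | succ n ih =>
      intro y hy
      refine le_trans ?_ (hdrift y (hX.reaches hx hy) fun hC => hcon y hC hy)
      push_cast
      gcongr
      rw [← mean_const (P y) n]
      exact mean_mono fun z hz => ih z (hy.tail hz)
  obtain ⟨n, hn⟩ := ENNReal.exists_nat_gt (hh x hx)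
  exact absurd (key n x .refl) (not_le.2 hn)

/-- If every state leads to the finite set `C`, then every state leads to an essential one. -/
theorem exists_reaches_essential {X C : Set E} (hX : IsClosedSet P X) (hC : (X ∩ C).Finite)
    (hreach : ∀ x ∈ X, ∃ c ∈ C, Reaches P x c) {x : E} (hx : x ∈ X) :
    ∃ y ∈ X, IsEssential P y ∧ Reaches P x y := by
  classical
  let r : E → Finset E := fun y => hC.toFinset.filter (Reaches P y)
  have hne : (X ∩ {y | Reaches P x y}).Nonempty := ⟨x, hx, .refl⟩
  -- Among the states reachable from `x`, `y` leads to the fewest points of `C`. By minimality,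
  -- whatever is reached from `y` still leads to all of these points, in particular to `c`.
  obtain ⟨y, ⟨hyX, hxy⟩, hmin⟩ := Function.argminOn_mem (fun y => (r y).card) _ hne |> fun hm =>
    (⟨_, hm, fun z hz => Function.argminOn_le (fun y => (r y).card) _ hz⟩ :
      ∃ y ∈ X ∩ {y | Reaches P x y}, ∀ z ∈ X ∩ {y | Reaches P x y}, (r y).card ≤ (r z).card)
  obtain ⟨c, hcC, hyc⟩ := hreach y hyX
  have hcX := hX.reaches hyX hyc
  have hxc : Reaches P x c := hxy.trans hyc
  refine ⟨c, hcX, fun z hcz => ?_, hxc⟩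
  have hsub : r z ⊆ r y := fun w hw => by
    simp only [r, Finset.mem_filter] at hw ⊢
    exact ⟨hw.1, hyc.trans (hcz.trans hw.2)⟩
  have heq : r z = r y :=
    Finset.eq_of_subset_of_card_le hsub (hmin z ⟨hX.reaches hcX hcz, hxc.trans hcz⟩)
  have : c ∈ r z := by
    rw [heq]
    simp only [r, Finset.mem_filter, Set.Finite.mem_toFinset]
    exact ⟨⟨hcX, hcC⟩, hyc⟩
  exact (Finset.mem_filter.1 this).2

end EntryTimes

/-! ### Stationary distributions -/

section Stationary

variable (P : E → PMF E) (x : E)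

/-- The taboo probabilities `Pr_x (X_n = y, X_1 ≠ x, …, X_n ≠ x)`. -/
noncomputable def taboo : ℕ → E → ℝ≥0∞
  | 0 => ({x} : Set E).indicator 1
  | n + 1 => ({x}ᶜ : Set E).indicator fun y => ∑' z, taboo n z * P z y

theorem tsum_taboo_succ_mul (n : ℕ) (f : E → ℝ≥0∞) :
    ∑' y, taboo P x (n + 1) y * f y
      = ∑' z, taboo P x n z * mean (P z) (({x}ᶜ : Set E).indicator f) := by
  simp only [mean, ← ENNReal.tsum_mul_left]
  rw [ENNReal.tsum_comm]
  refine tsum_congr fun y => ?_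
  by_cases hy : y ∈ ({x}ᶜ : Set E)
  · simp only [taboo, Set.indicator_of_mem hy, ← ENNReal.tsum_mul_right]
    exact tsum_congr fun z => by ring
  · simp [taboo, Set.indicator_of_notMem hy]

theorem tsum_taboo (n : ℕ) : ∑' y, taboo P x n y = avoid P {x} n x := by
  -- Markov property at time `n`; the induction moves one step at a time from `avoid` to `taboo`.
  have key : ∀ n k, ∑' y, taboo P x n y * avoid P {x} k y = avoid P {x} (n + k) x := by
    intro n
    induction n with
    | zero =>
      intro k
      rw [tsum_eq_single x]
      · simp [taboo]
      · intro y hy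
        simp [taboo, hy]
    | succ n ih =>
      intro k
      rw [tsum_taboo_succ_mul]
      have := ih (k + 1)
      simp only [avoid_succ] at this
      rw [this]
      congr 1
      omega
  simpa [avoid] using key n 0

variable {P x}

theorem taboo_eq_zero {X : Set E} (hX : IsClosedSet P X) (hx : x ∈ X) (n : ℕ) {y : E}
    (hy : y ∉ X) : taboo P x n y = 0 := by
  induction n generalizing y with
  | zero =>
    have : y ≠ x := fun h => hy (h ▸ hx)
    simp [taboo, this]
  | succ n ih =>
    have : ∑' z, taboo P x n z * P z y = 0 := by
      refine ENNReal.tsum_eq_zero.2 fun z => ?_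
      by_cases hz : z ∈ X
      · have : P z y = 0 := (PMF.apply_eq_zero_iff _ _).2 fun h => hy (hX z hz y h)
        simp [this]
      · simp [ih hz]
    by_cases hyx : y ∈ ({x}ᶜ : Set E)
    · simp [taboo, Set.indicator_of_mem hyx, this]
    · simp [taboo, Set.indicator_of_notMem hyx]

/-- A state with a finite mean return time carries a stationary distribution. -/
theorem exists_isStationary {X : Set E} (hX : IsClosedSet P X) (hx : x ∈ X)
    (hfin : meanEntryTime P {x} x < ∞) : ∃ π, IsStationary P X π := by
  -- The mean numbers of visits during one excursion from `x`, the return excluded.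
  set μ : E → ℝ≥0∞ := fun y => ∑' n, taboo P x n y with hμ
  have hμx : μ x = 1 := by
    rw [hμ]
    simp only
    rw [tsum_eq_single 0]
    · simp [taboo]
    · intro n hn
      obtain ⟨k, rfl⟩ := Nat.exists_eq_succ_of_ne_zero hn
      simp [taboo]
  have hsum : ∑' y, μ y = meanEntryTime P {x} x := by
    rw [hμ, ENNReal.tsum_comm]
    exact tsum_congr fun n => tsum_taboo P x n
  have hstep : ∀ y, y ≠ x → ∑' z, μ z * P z y = μ y := by
    intro y hy
    have h0 : taboo P x 0 y = 0 := by simp [taboo, hy]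
    rw [hμ]
    simp only [← ENNReal.tsum_mul_right]
    rw [ENNReal.tsum_comm, tsum_eq_zero_add' (f := fun n => taboo P x n y) ENNReal.summable, h0,
      zero_add]
    exact tsum_congr fun n => by simp [taboo, hy]
  have htot : ∑' y, ∑' z, μ z * P z y = ∑' y, μ y := by
    rw [ENNReal.tsum_comm]
    simp only [ENNReal.tsum_mul_left, PMF.tsum_coe, mul_one]
  -- Balance at `x` follows from balance elsewhere and equality of the total masses, which are
  -- finite.
  have hstepx : ∑' z, μ z * P z x = μ x := by
    classical
    have h1 := ENNReal.tsum_eq_add_tsum_ite (f := fun y => ∑' z, μ z * P z y) x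
    have h2 := ENNReal.tsum_eq_add_tsum_ite (f := μ) x
    have h3 : (∑' y, if y = x then 0 else ∑' z, μ z * P z y) = ∑' y, if y = x then 0 else μ y :=
      tsum_congr fun y => by
        split_ifs with h
        · rfl
        · exact hstep y h
    rw [htot, h2, h3] at h1
    have hne : (∑' y, if y = x then 0 else μ y) ≠ ∞ := by
      refine ((ENNReal.tsum_le_tsum fun y => ?_).trans_lt (hsum ▸ hfin)).ne
      split_ifs <;> simp
    exact ((ENNReal.add_left_inj hne).1 h1).symm
  have hinv : ∀ y, ∑' z, μ z * P z y = μ y := fun y => by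
    by_cases hy : y = x
    · rw [hy, hstepx]
    · exact hstep y hy
  have hμ0 : ∑' y, μ y ≠ 0 := fun h => by
    have := ENNReal.tsum_eq_zero.1 h x
    rw [hμx] at this
    exact one_ne_zero this
  have hμtop : ∑' y, μ y ≠ ∞ := (hsum ▸ hfin).ne
  refine ⟨PMF.normalize μ hμ0 hμtop, fun y hy => ?_, ?_⟩
  · by_contra hyX
    rw [PMF.mem_support_normalize_iff] at hy
    exact hy (ENNReal.tsum_eq_zero.2 fun n => taboo_eq_zero hX hx n hyX)
  · ext y
    rw [PMF.bind_apply]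
    simp only [PMF.normalize_apply]
    rw [← hinv y, ← ENNReal.tsum_mul_right]
    exact tsum_congr fun z => by ring

/-- The Lyapunov bound `π g ≤ b` for stationary distributions `π` when `P h + g ≤ h + b`. -/
theorem IsStationary.mean_le {X : Set E} {π : PMF E} (hπ : IsStationary P X π) {h g : E → ℝ≥0∞}
    {b : ℝ≥0∞} (hh : ∀ x ∈ X, h x ≠ ∞) (hdrift : ∀ x ∈ X, mean (P x) h + g x ≤ h x + b) :
    mean π g ≤ b := by
  classical
  have htrunc : ∀ N : ℕ, mean π (fun y => if h y ≤ N then g y else 0) ≤ b := by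
    intro N
    -- The mean of `h` under `π` may be infinite. Its truncation has a finite mean that cancels by
    -- stationarity, and it keeps the drift inequality where `h ≤ N`.
    set hN : E → ℝ≥0∞ := fun y => min (h y) N with hhN
    have h1 : mean π (fun y => mean (P y) hN + if h y ≤ N then g y else 0)
        ≤ mean π (fun y => hN y + b) := by
      refine mean_mono fun y hy => ?_
      split_ifs with hle
      · have : hN y = h y := min_eq_left hle
        rw [this]
        refine le_trans ?_ (hdrift y (hπ.1 hy))
        gcongr
        exact mean_mono fun z _ => min_le_left _ _
      · have : hN y = N := min_eq_right (not_le.1 hle).le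
        rw [this, add_zero]
        refine le_trans ?_ le_self_add
        exact (mean_mono fun z _ => min_le_right _ _).trans (mean_const _ _).le
    rw [mean_add, mean_add, mean_const, ← mean_bind, hπ.2] at h1
    refine (ENNReal.add_le_add_iff_left ?_).1 h1
    refine ((mean_mono (g := fun _ => (N : ℝ≥0∞)) fun z _ => min_le_right _ _).trans_lt ?_).ne
    rw [mean_const]
    exact ENNReal.natCast_lt_top N
  rw [mean, ENNReal.tsum_eq_iSup_sum]
  refine iSup_le fun s => ?_
  obtain ⟨N, hN⟩ : ∃ N : ℕ, ∀ y ∈ s, y ∈ X → h y ≤ N := by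
    have : ∀ y ∈ s, ∃ n : ℕ, y ∈ X → h y ≤ n := fun y _ => by
      by_cases hy : y ∈ X
      · obtain ⟨n, hn⟩ := ENNReal.exists_nat_gt (hh y hy)
        exact ⟨n, fun _ => hn.le⟩
      · exact ⟨0, fun h => absurd h hy⟩
    choose! n hn using this
    refine ⟨s.sup n, fun y hy hyX => (hn y hy hyX).trans ?_⟩
    exact_mod_cast Finset.le_sup hy
  refine le_trans ?_ (htrunc N)
  refine le_trans (Finset.sum_le_sum fun y hy => ?_) (ENNReal.sum_le_tsum s)
  by_cases hyX : y ∈ X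
  · simp [hN y hy hyX]
  · have : π y = 0 := (PMF.apply_eq_zero_iff _ _).2 fun h => hyX (hπ.1 h)
    simp [this]

end Stationary

/-! ### Criteria for positive recurrence and transience -/

/-- Foster's criterion with a moment bound. -/
theorem positiveRecurrent_of_drift {P : E → PMF E} {X : Set E} (hX : IsClosedSet P X)
    (hne : X.Nonempty) {h g : E → ℝ≥0∞} {b : ℝ≥0∞} (hb : b ≠ ∞) (hh : ∀ x ∈ X, h x ≠ ∞)
    (hdrift : ∀ x ∈ X, mean (P x) h + g x ≤ h x + b)
    (hfin : ∀ c : ℝ≥0∞, c ≠ ∞ → {x | x ∈ X ∧ g x ≤ c}.Finite) :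
    IsPositiveRecurrent P X ∧ (∃ π, IsStationary P X π) ∧
      ∀ π, IsStationary P X π → mean π g ≤ b := by
  -- Outside `C` the term `g` exceeds `b` by at least one, so `h` has drift at most `-1` there.
  set C : Set E := {x | g x ≤ b + 1} with hC
  have hCfin : (X ∩ C).Finite := hfin (b + 1) (by simp [hb])
  have hP : ∀ x ∈ X, mean (P x) h ≠ ∞ := fun x hx =>
    ((le_self_add.trans (hdrift x hx)).trans_lt
      (ENNReal.add_ne_top.2 ⟨hh x hx, hb⟩).lt_top).ne
  have hd : ∀ x ∈ X, x ∉ C → mean (P x) h + 1 ≤ h x := fun x hx hxC => by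
    refine (ENNReal.add_le_add_iff_right hb).1 (le_trans ?_ (hdrift x hx))
    rw [add_assoc, add_comm 1 b]
    gcongr
    exact (not_le.1 hxC).le
  have hrC : ∀ x ∈ X, ∃ c ∈ C, Reaches P x c := fun x hx => exists_reaches hX hh hd hx
  have hess : ∀ x ∈ X, IsEssential P x → meanEntryTime P {x} x < ∞ := by
    intro x hx hxe
    have hsub : ∀ y, y ∈ {y | Reaches P x y} → y ∈ X := fun y hy => hX.reaches hx hy
    -- The chain is restricted to the states reachable from `x`, all of which lead back to `x`.
    refine meanEntryTime_lt_top (A := {x}) (isClosedSet_reaches P x) (C := C)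
      (hCfin.subset fun y hy => ⟨hsub y hy.1, hy.2⟩) (fun y hy => hP y (hsub y hy))
      (fun y hy => hd y (hsub y hy)) (fun c hc => ⟨x, rfl, hxe c hc.1⟩) .refl
  have hall : ∀ x ∈ X, meanEntryTime P {y | y ∈ X ∧ IsEssential P y} x < ∞ := by
    intro x hx
    refine meanEntryTime_lt_top hX hCfin hP hd (fun c hc => ?_) hx
    obtain ⟨y, hy, hye, hcy⟩ := exists_reaches_essential hX hCfin hrC hc.1
    exact ⟨y, ⟨hy, hye⟩, hcy⟩
  refine ⟨⟨hess, hall⟩, ?_, fun π hπ => hπ.mean_le hh hdrift⟩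
  obtain ⟨x, hx⟩ := hne
  obtain ⟨y, hy, hye, -⟩ := exists_reaches_essential hX hCfin hrC hx
  exact exists_isStationary hX hy (hess y hy hye)

/-- If `f` is superharmonic off `C`, at least `c` on `C` and at `x`, and less than `c` at a state
that can be reached from `x`, then `x` is transient. -/
theorem isTransientState_of_superharmonic {P : E → PMF E} {X C : Set E} (hX : IsClosedSet P X)
    {f : E → ℝ≥0∞} (hf : ∀ y ∈ X, y ∉ C → mean (P y) f ≤ f y) {x z : E} (hx : x ∈ X)
    (hC : ∀ y ∈ X ∩ C, 1 ≤ f y) (hfx : 1 ≤ f x) (hxz : Reaches P x z) (hz : f z < 1) :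
    IsTransientState P x := by
  classical
  -- A bound `Pr (x is hit) ≤ f` without optional stopping: hitting `x` is paid for by `f x ≥ 1`,
  -- and on `C` the claim is trivial.
  have havoid : ∀ n, ∀ y ∈ X, 1 ≤ avoid P {x} n y + f y := by
    intro n
    induction n with
    | zero => intro y _; simp [avoid]
    | succ n ih =>
      intro y hy
      by_cases hyC : y ∈ C
      · exact (hC y ⟨hy, hyC⟩).trans le_add_self
      rw [avoid_succ]
      calc (1 : ℝ≥0∞) = mean (P y) (fun _ => 1) := (mean_const _ _).symm
        _ ≤ mean (P y) (fun w => ({x}ᶜ : Set E).indicator (avoid P {x} n) w + f w) := by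
          refine mean_mono fun w hw => ?_
          by_cases hwx : w = x
          · subst hwx
            exact hfx.trans le_add_self
          · have : w ∈ ({x}ᶜ : Set E) := hwx
            rw [Set.indicator_of_mem this]
            exact ih w (hX y hy w hw)
        _ ≤ _ := by
          rw [mean_add]
          gcongr
          exact hf y hy hyC
  set v : E → ℝ≥0∞ := fun y => ⨅ n, avoid P {x} n y with hv
  have hvz : 0 < v z := by
    refine lt_of_lt_of_le (tsub_pos_of_lt hz) (le_iInf fun n => ?_)
    exact tsub_le_iff_right.2 (havoid n z (hX.reaches hx hxz))
  have hvstep : ∀ y w, w ∈ (P y).support → w ≠ x → 0 < v w → 0 < v y := by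
    intro y w hw hwx hvw
    refine lt_of_lt_of_le (ENNReal.mul_pos hw hvw.ne') (le_iInf fun n => ?_)
    cases n with
    | zero =>
      refine (mul_le_mul' (PMF.coe_le_one _ _) (iInf_le _ 0)).trans ?_
      simp [avoid]
    | succ n =>
      rw [avoid_succ]
      refine le_trans ?_ (mul_le_mean _ _ w)
      have : w ∈ ({x}ᶜ : Set E) := hwx
      rw [Set.indicator_of_mem this]
      gcongr
      exact iInf_le _ n
  -- Positivity of the escape probability is carried back along the path from `z`; if the path
  -- passes through `x` again, positivity at `x` is already known.
  have : ∀ y, Reaches P y z → 0 < v y ∨ 0 < v x := by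
    intro y hy
    induction hy using Relation.ReflTransGen.head_induction_on with
    | refl => exact Or.inl hvz
    | @head y w hyw _ ih =>
      rcases ih with h | h
      · by_cases hwx : w = x
        · exact Or.inr (hwx ▸ h)
        · exact Or.inl (hvstep y w hyw hwx h)
      · exact Or.inr h
  exact (this x hxz).elim id id

end Chain

/-! ### Schedules and service quanta -/

namespace RCSystem

variable {L J : ℕ} (sys : RCSystem L J)

theorem serviceReq_pos (l : Fin L) : 0 < sys.serviceReq l := by
  have h1 := Real.log_neg (sys.errProb_pos l) (sys.errProb_lt_one l)
  have h2 : 0 ≤ Real.log (sys.alphabet l) :=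
    Real.log_nonneg (by exact_mod_cast sys.alphabet_pos l)
  have h3 := mul_nonneg sys.rho_pos.le h2
  unfold serviceReq
  linarith

theorem exists_power_bounds : ∃ p q : ℝ, 0 < p ∧ ∀ j, p ≤ sys.power j ∧ sys.power j ≤ q := by
  rcases isEmpty_or_nonempty (Fin J) with h | h
  · exact ⟨1, 1, one_pos, fun j => h.elim j⟩
  · obtain ⟨i, hi⟩ := Finite.exists_min sys.power
    obtain ⟨k, hk⟩ := Finite.exists_max sys.power
    exact ⟨_, _, sys.power_pos i, fun j => ⟨hi j, hk j⟩⟩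

theorem exists_serviceReq_le : ∃ B : ℝ, 0 < B ∧ ∀ l, sys.serviceReq l ≤ B := by
  rcases isEmpty_or_nonempty (Fin L) with h | h
  · exact ⟨1, one_pos, fun l => h.elim l⟩
  · obtain ⟨k, hk⟩ := Finite.exists_max sys.serviceReq
    exact ⟨_, sys.serviceReq_pos k, hk⟩

section Schedules

variable (α : RCState L J) (T : Finset (Fin α.length))

/-- Converts sums over classes into sums over transmitting positions; used in `ℕ` for counts and in
`ℝ` for powers. -/
theorem sum_scheduleOf_nsmul {M : Type*} [AddCommMonoid M] (f : Fin J → M) :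
    ∑ l, ∑ j, scheduleOf α T l j • f j = ∑ k ∈ T, f (α.get k).pow := by
  classical
  rw [← Fintype.sum_prod_type' (f := fun l j => scheduleOf α T l j • f j),
    ← Finset.sum_fiberwise T (fun k => ((α.get k).req, (α.get k).pow))]
  refine Finset.sum_congr rfl fun c _ => ?_
  rw [Finset.sum_congr rfl (g := fun _ => f c.2)]
  · rw [Finset.sum_const, scheduleOf]
    congr 3
    ext k
    simp [Prod.ext_iff]
  · intro k hk
    rw [← (Finset.mem_filter.1 hk).2]

theorem sum_scheduleOf : ∑ l, ∑ j, scheduleOf α T l j = T.card := by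
  simpa using sum_scheduleOf_nsmul α T (fun _ => (1 : ℕ))

variable {T} in
theorem sum_scheduleOf_pos {k : Fin α.length} (hk : k ∈ T) :
    0 < ∑ l, scheduleOf α T l (α.get k).pow := by
  refine lt_of_lt_of_le ?_ (Finset.single_le_sum (f := fun l => scheduleOf α T l (α.get k).pow)
    (fun _ _ => Nat.zero_le _) (Finset.mem_univ (α.get k).req))
  exact Finset.card_pos.2 ⟨k, by simp [hk]⟩

theorem noise_scheduleOf (j : Fin J) :
    sys.noise (scheduleOf α T) j
      = sys.N0 * sys.W + (∑ k ∈ T, sys.power (α.get k).pow - sys.power j) := by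
  rw [noise, ← sum_scheduleOf_nsmul]
  simp only [nsmul_eq_mul]

end Schedules

theorem noise_pos {s : RCSchedule L J} {j : Fin J} (hs : 0 < ∑ l, s l j) :
    0 < sys.noise s j := by
  have h0 : ∀ l i, 0 ≤ (s l i : ℝ) * sys.power i := fun l i =>
    mul_nonneg (Nat.cast_nonneg _) (sys.power_pos i).le
  have h1 : sys.power j ≤ ∑ l, ∑ i, (s l i : ℝ) * sys.power i := by
    calc sys.power j ≤ ((∑ l, s l j : ℕ) : ℝ) * sys.power j :=
          le_mul_of_one_le_left (sys.power_pos j).le (by exact_mod_cast hs)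
      _ = ∑ l, (s l j : ℝ) * sys.power j := by push_cast; rw [Finset.sum_mul]
      _ ≤ _ := Finset.sum_le_sum fun l _ =>
          Finset.single_le_sum (fun i _ => h0 l i) (Finset.mem_univ j)
  have h2 := mul_pos sys.N0_pos sys.W_pos
  unfold noise
  linarith

theorem quantum_pos {s : RCSchedule L J} {j : Fin J} (hs : 0 < ∑ l, s l j) :
    0 < sys.quantum s j := by
  rw [quantum, if_pos hs]
  refine mul_pos sys.rho_pos (Real.log_pos ?_)
  have h1 := div_pos (sys.power_pos j)
    (mul_pos (show 0 < 1 + sys.rho by linarith [sys.rho_pos]) (sys.noise_pos hs))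
  linarith

theorem quantum_nonneg (s : RCSchedule L J) (j : Fin J) : 0 ≤ sys.quantum s j := by
  by_cases hs : 0 < ∑ l, s l j
  · exact (sys.quantum_pos hs).le
  · rw [quantum, if_neg hs]

theorem quantum_le {s : RCSchedule L J} {j : Fin J} (hs : 0 < ∑ l, s l j) :
    sys.quantum s j ≤ sys.rho / (1 + sys.rho) * (sys.power j / sys.noise s j) := by
  have hr : 0 < 1 + sys.rho := by linarith [sys.rho_pos]
  have hn := sys.noise_pos hs
  have hx := div_pos (sys.power_pos j) (mul_pos hr hn)
  rw [quantum, if_pos hs]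
  calc sys.rho * Real.log (1 + sys.power j / ((1 + sys.rho) * sys.noise s j))
      ≤ sys.rho * (sys.power j / ((1 + sys.rho) * sys.noise s j)) := by
        refine mul_le_mul_of_nonneg_left ?_ sys.rho_pos.le
        have := Real.log_le_sub_one_of_pos (show 0 < 1 + sys.power j /
          ((1 + sys.rho) * sys.noise s j) by linarith)
        linarith
    _ = _ := by field_simp

/-- From `1 - 1/y ≤ log y`. Adding the message's own power to the noise makes the denominator the
same for all transmitting messages, so the bounds can be summed. -/
theorem le_quantum {s : RCSchedule L J} {j : Fin J} (hs : 0 < ∑ l, s l j) :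
    sys.rho / (1 + sys.rho) * (sys.power j / (sys.noise s j + sys.power j))
      ≤ sys.quantum s j := by
  have hr : 0 < 1 + sys.rho := by linarith [sys.rho_pos]
  have hn := sys.noise_pos hs
  have hp := sys.power_pos j
  have hx := div_pos hp (mul_pos hr hn)
  rw [quantum, if_pos hs]
  rw [div_mul_eq_mul_div, mul_div_assoc]
  refine mul_le_mul_of_nonneg_left ?_ sys.rho_pos.le
  refine le_trans ?_ (Real.one_sub_inv_le_log_of_pos (by linarith))
  have e : 1 - (1 + sys.power j / ((1 + sys.rho) * sys.noise s j))⁻¹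
      = sys.power j / ((1 + sys.rho) * sys.noise s j + sys.power j) := by
    field_simp
    ring
  rw [e, div_div]
  refine div_le_div_of_nonneg_left hp.le (by positivity) ?_
  nlinarith [mul_pos sys.rho_pos hp]

/-! ### Total and individual service for many transmissions -/

section ManyTransmissions

theorem eventually_le_sum_power (t : ℝ) : ∀ᶠ K : ℕ in atTop, ∀ (α : RCState L J)
    (T : Finset (Fin α.length)), T.card = K → t ≤ ∑ k ∈ T, sys.power (α.get k).pow := by
  obtain ⟨p, q, hp, hpq⟩ := sys.exists_power_bounds
  have h : Tendsto (fun K : ℕ => (K : ℝ) * p) atTop atTop :=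
    tendsto_natCast_atTop_atTop.atTop_mul_const hp
  filter_upwards [h.eventually_ge_atTop t] with K hK α T hT
  calc t ≤ K * p := hK
    _ = ∑ k ∈ T, p := by rw [Finset.sum_const, hT, nsmul_eq_mul]
    _ ≤ _ := Finset.sum_le_sum fun k _ => (hpq _).1

/-- The total service in a slot with many transmissions is not much less than `ρ / (1 + ρ)`. -/
theorem eventually_le_sum_quantum {D : ℝ} (hD : D < sys.rho / (1 + sys.rho)) :
    ∀ᶠ K : ℕ in atTop, ∀ (α : RCState L J) (T : Finset (Fin α.length)), T.card = K →
      D ≤ ∑ k ∈ T, sys.quantum (scheduleOf α T) (α.get k).pow := by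
  have hn := mul_pos sys.N0_pos sys.W_pos
  have hd := sub_pos.2 hD
  -- The second threshold is the solution `x` of `D = ρ/(1+ρ) · x/(N₀W + x)`; the first keeps the
  -- denominator positive.
  filter_upwards [sys.eventually_le_sum_power 1, sys.eventually_le_sum_power
    (D * (sys.N0 * sys.W) / (sys.rho / (1 + sys.rho) - D))] with K h1 h2 α T hT
  have h1 := h1 α T hT
  have h2 := h2 α T hT
  rw [div_le_iff₀ hd] at h2
  set x := ∑ k ∈ T, sys.power (α.get k).pow with hx
  calc D ≤ sys.rho / (1 + sys.rho) * (x / (sys.N0 * sys.W + x)) := by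
        rw [← mul_div_assoc, le_div_iff₀ (by positivity)]
        linarith
    _ = ∑ k ∈ T, sys.rho / (1 + sys.rho) * (sys.power (α.get k).pow / (sys.N0 * sys.W + x)) := by
        rw [← Finset.mul_sum, ← Finset.sum_div]
    _ ≤ _ := Finset.sum_le_sum fun k hk => by
        refine le_trans (le_of_eq ?_) (sys.le_quantum (sum_scheduleOf_pos α hk))
        rw [noise_scheduleOf]
        congr 2
        ring

/-- Dropping the thermal noise and replacing the own power by `q` again gives a common denominator.
-/
theorem quantum_le_of_sum_power {α : RCState L J} {T : Finset (Fin α.length)} {q : ℝ}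
    (hq : ∀ j, sys.power j ≤ q) (hx : q < ∑ k ∈ T, sys.power (α.get k).pow)
    {k : Fin α.length} (hk : k ∈ T) :
    sys.quantum (scheduleOf α T) (α.get k).pow ≤ sys.rho / (1 + sys.rho) *
      (sys.power (α.get k).pow / (∑ k ∈ T, sys.power (α.get k).pow - q)) := by
  have hr : 0 < 1 + sys.rho := by linarith [sys.rho_pos]
  refine (sys.quantum_le (sum_scheduleOf_pos α hk)).trans ?_
  refine mul_le_mul_of_nonneg_left ?_ (div_pos sys.rho_pos hr).le
  refine div_le_div_of_nonneg_left (sys.power_pos _).le (sub_pos.2 hx) ?_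
  rw [noise_scheduleOf]
  linarith [hq (α.get k).pow, mul_pos sys.N0_pos sys.W_pos]

/-- The total service in a slot with many transmissions is not much more than `ρ / (1 + ρ)`. -/
theorem eventually_sum_quantum_le {D : ℝ} (hD : sys.rho / (1 + sys.rho) < D) :
    ∀ᶠ K : ℕ in atTop, ∀ (α : RCState L J) (T : Finset (Fin α.length)), T.card = K →
      ∑ k ∈ T, sys.quantum (scheduleOf α T) (α.get k).pow ≤ D := by
  obtain ⟨p, q, hp, hpq⟩ := sys.exists_power_bounds
  have hd := sub_pos.2 hD
  filter_upwards [sys.eventually_le_sum_power (q + 1), sys.eventually_le_sum_power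
    (D * q / (D - sys.rho / (1 + sys.rho)))] with K h1 h2 α T hT
  have h1 := h1 α T hT
  have h2 := h2 α T hT
  rw [div_le_iff₀ hd] at h2
  refine (Finset.sum_le_sum fun k hk =>
    sys.quantum_le_of_sum_power (fun j => (hpq j).2) (by linarith) hk).trans ?_
  rw [← Finset.mul_sum, ← Finset.sum_div, ← mul_div_assoc, div_le_iff₀ (by linarith)]
  linarith

/-- The individual services in a slot with many transmissions are small. -/
theorem eventually_quantum_le {ε : ℝ} (hε : 0 < ε) :
    ∀ᶠ K : ℕ in atTop, ∀ (α : RCState L J) (T : Finset (Fin α.length)), T.card = K →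
      ∀ k ∈ T, sys.quantum (scheduleOf α T) (α.get k).pow ≤ ε := by
  obtain ⟨p, q, hp, hpq⟩ := sys.exists_power_bounds
  have hr : 0 < 1 + sys.rho := by linarith [sys.rho_pos]
  filter_upwards [sys.eventually_le_sum_power (q + 1), sys.eventually_le_sum_power
    (q + sys.rho / (1 + sys.rho) * q / ε)] with K h1 h2 α T hT k hk
  have h1 := h1 α T hT
  have h2 := h2 α T hT
  refine (sys.quantum_le_of_sum_power (fun j => (hpq j).2) (by linarith) hk).trans ?_
  rw [← mul_div_assoc, div_le_iff₀ (by linarith)]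
  have h3 : sys.rho / (1 + sys.rho) * q / ε
    ≤ ∑ k ∈ T, sys.power (α.get k).pow - q := by linarith
  rw [div_le_iff₀ hε] at h3
  have h4 : sys.rho / (1 + sys.rho) * sys.power (α.get k).pow
    ≤ sys.rho / (1 + sys.rho) * q :=
    mul_le_mul_of_nonneg_left (hpq _).2 (div_pos sys.rho_pos hr).le
  linarith

end ManyTransmissions

/-! ### Finiteness of the state space at bounded length -/

section StateSpace

variable {sys} {K : ℕ}

theorem IsResidual.pos {l : Fin L} {j : Fin J} {x : ℝ} (h : sys.IsResidual K l j x) : 0 < x := by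
  cases h with
  | fresh => exact sys.serviceReq_pos l
  | serve _ _ _ _ _ h => exact h

theorem IsResidual.le {l : Fin L} {j : Fin J} {x : ℝ} (h : sys.IsResidual K l j x) :
    x ≤ sys.serviceReq l := by
  induction h with
  | fresh => exact le_rfl
  | serve x s _ _ _ _ ih => linarith [sys.quantum_nonneg s j]

theorem finite_schedules (K : ℕ) : {s : RCSchedule L J | ∑ l, ∑ j, s l j ≤ K}.Finite := by
  refine (Set.finite_Iic (fun _ _ => K : RCSchedule L J)).subset fun s hs l j => ?_
  have h1 : s l j ≤ ∑ j, s l j :=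
    Finset.single_le_sum (fun _ _ => Nat.zero_le _) (Finset.mem_univ j)
  refine h1.trans (le_trans ?_ hs)
  exact Finset.single_le_sum (f := fun l => ∑ j, s l j) (fun _ _ => Nat.zero_le _)
      (Finset.mem_univ l)

variable (sys) in
theorem exists_quantum_ge (K : ℕ) (j : Fin J) : ∃ q : ℝ, 0 < q ∧ ∀ s : RCSchedule L J,
    ∑ l, ∑ j, s l j ≤ K → 0 < ∑ l, s l j → q ≤ sys.quantum s j := by
  have hfin : {s : RCSchedule L J | ∑ l, ∑ j, s l j ≤ K ∧ 0 < ∑ l, s l j}.Finite :=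
    (finite_schedules K).subset fun s hs => hs.1
  rcases Set.eq_empty_or_nonempty {s : RCSchedule L J | ∑ l, ∑ j, s l j ≤ K ∧ 0 < ∑ l, s l j}
    with h | h
  · exact ⟨1, one_pos, fun s h1 h2 => 
      absurd ⟨h1, h2⟩ (Set.eq_empty_iff_forall_notMem.1 h s)⟩
  · obtain ⟨t, ht, hmin⟩ := Set.exists_min_image _ (fun s => sys.quantum s j) hfin h
    exact ⟨_, sys.quantum_pos ht.2, fun s h1 h2 => hmin s ⟨h1, h2⟩⟩

variable (sys) in
-- Finitely many schedules give a positive least quantum, so a message is served a bounded number of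
-- times before its residual is exhausted. `F n` contains all values after `n` services.
theorem finite_isResidual (K : ℕ) (l : Fin L) (j : Fin J) :
    {x | sys.IsResidual K l j x}.Finite := by
  obtain ⟨q, hq, hqs⟩ := sys.exists_quantum_ge K j
  let F : ℕ → Set ℝ := fun n => Nat.rec {sys.serviceReq l}
    (fun _ A => Set.image2 (fun x s => x - sys.quantum s j) A
      {s : RCSchedule L J | ∑ l, ∑ j, s l j ≤ K}) n
  have hF : ∀ n, (F n).Finite := by
    intro n
    induction n with
    | zero => exact Set.finite_singleton _
    | succ n ih => exact ih.image2 _ (finite_schedules K)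
  have hmem : ∀ x, sys.IsResidual K l j x → ∃ n : ℕ, x ∈ F n ∧ x ≤ sys.serviceReq l - n * q := by
    intro x hx
    induction hx with
    | fresh => exact ⟨0, rfl, by simp⟩
    | serve x s _ hs hj _ ih =>
      obtain ⟨n, hn, hle⟩ := ih
      refine ⟨n + 1, ⟨x, hn, s, hs, rfl⟩, ?_⟩
      push_cast
      linarith [hqs s hs hj]
  obtain ⟨N, hN⟩ := exists_nat_gt (sys.serviceReq l / q)
  rw [div_lt_iff₀ hq] at hN
  refine ((Set.finite_Iio N).biUnion fun n _ => hF n).subset fun x hx => ?_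
  obtain ⟨n, hn, hle⟩ := hmem x hx
  refine Set.mem_biUnion (x := n) ?_ hn
  by_contra hnN
  have : (N : ℝ) ≤ n := by exact_mod_cast not_lt.1 hnN
  have hx0 : 0 < x := IsResidual.pos hx
  nlinarith

variable (sys) in
/-- The messages that can be in the system. -/
def messages (K : ℕ) : Set (RCMessage L J) := {m | sys.IsResidual K m.req m.pow m.residual}

variable (sys) in
theorem finite_messages (K : ℕ) : (sys.messages K).Finite := by
  have : (⋃ c : Fin L × Fin J, (fun x => (⟨x, c.1, c.2⟩ : RCMessage L J)) ''
      {x | sys.IsResidual K c.1 c.2 x}).Finite :=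
    Set.finite_iUnion fun c => (sys.finite_isResidual K c.1 c.2).image _
  refine this.subset fun m hm => Set.mem_iUnion.2 ⟨(m.req, m.pow), m.residual, hm, rfl⟩

variable (sys) in
theorem finite_stateSpace_length_le (K N : ℕ) :
    {α | α ∈ sys.stateSpace K ∧ α.length ≤ N}.Finite := by
  have := (sys.finite_messages K).to_subtype
  refine ((List.finite_length_le (sys.messages K) N).image
    (List.map Subtype.val)).subset fun α hα => ?_
  obtain ⟨l, rfl⟩ : α ∈ Set.range (List.map ((↑) : sys.messages K → RCMessage L J)) := by
    rw [Set.range_list_map_coe]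
    exact hα.1
  exact ⟨l, by simpa using hα.2, rfl⟩

variable (sys) in
theorem exists_residual_ge (K : ℕ) : ∃ r : ℝ, 0 < r ∧ ∀ m ∈ sys.messages K, r ≤ m.residual := by
  rcases (sys.messages K).eq_empty_or_nonempty with h | h
  · exact ⟨1, one_pos, by simp [h]⟩
  · obtain ⟨t, ht, hmin⟩ := Set.exists_min_image _ RCMessage.residual (sys.finite_messages K) h
    exact ⟨_, IsResidual.pos ht, hmin⟩

end StateSpace

/-! ### One slot of the chain and additive weights -/

section Dynamics

variable {K : ℕ}

theorem mem_support_step {ω : RCPolicy L J K} {α β : RCState L J}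
    (h : β ∈ (sys.step ω α).support) :
    ∃ T : Finset (Fin α.length), T.card = min α.length K ∧
      ∃ a, β = sys.afterService α T ++ sys.batch a := by
  rw [step, PMF.mem_support_bind_iff] at h
  obtain ⟨T, hT, h⟩ := h
  rw [PMF.mem_support_map_iff] at h
  obtain ⟨a, -, rfl⟩ := h
  exact ⟨T, ω.nonIdling α T hT, a, rfl⟩

theorem isClosedSet_stateSpace (ω : RCPolicy L J K) :
    Chain.IsClosedSet (sys.step ω) (sys.stateSpace K) := by
  intro α hα β hβ
  obtain ⟨T, hT, a, rfl⟩ := sys.mem_support_step hβ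
  intro m hm
  rcases List.mem_append.1 hm with hm | hm
  · obtain ⟨k, -, hk⟩ := List.mem_filterMap.1 hm
    have hres := hα _ (List.get_mem α k)
    split_ifs at hk with h1 h2
    · obtain rfl := Option.some.inj hk
      refine .serve _ _ hres ?_ (sum_scheduleOf_pos α h1) (by linarith)
      rw [sum_scheduleOf, hT]
      exact min_le_right _ _
    · obtain rfl := Option.some.inj hk
      exact hres
  · simp only [batch, List.mem_flatMap, List.mem_replicate] at hm
    obtain ⟨l, -, j, -, -, rfl⟩ := hm
    exact .fresh

/-- The sum of the weights `w` of the messages of a state. -/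
def total (w : RCMessage L J → ℝ) (α : RCState L J) : ℝ := (α.map w).sum

theorem total_append (w : RCMessage L J → ℝ) (α β : RCState L J) :
    total w (α ++ β) = total w α + total w β := by
  simp [total]

theorem total_eq_sum (w : RCMessage L J → ℝ) (α : RCState L J) :
    total w α = ∑ k, w (α.get k) := by
  rw [Fin.sum_univ_def, total]
  congr 1
  exact List.ext_getElem (by simp) (by simp)

theorem total_filterMap {ι : Type*} (w : RCMessage L J → ℝ) (l : List ι)
    (f : ι → Option (RCMessage L J)) :
    total w (l.filterMap f) = (l.map fun k => (f k).elim 0 w).sum := by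
  induction l with
  | nil => rfl
  | cons k l ih =>
    rw [List.filterMap_cons]
    cases h : f k with
    | none => simp [h, ih]
    | some m =>
      rw [List.map_cons, List.sum_cons, ← ih, h]
      rfl

/-- The weight that the message at position `k` has after the slot. -/
noncomputable def weightAfter (w : RCMessage L J → ℝ) (α : RCState L J) (T : Finset (Fin α.length))
    (k : Fin α.length) : ℝ :=
  if k ∈ T then
    if (α.get k).residual ≤ sys.quantum (scheduleOf α T) (α.get k).pow then 0
    else w ⟨(α.get k).residual - sys.quantum (scheduleOf α T) (α.get k).pow,
      (α.get k).req, (α.get k).pow⟩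
  else w (α.get k)

theorem total_afterService (w : RCMessage L J → ℝ) (α : RCState L J)
    (T : Finset (Fin α.length)) :
    total w (sys.afterService α T) = ∑ k, sys.weightAfter w α T k := by
  rw [afterService, total_filterMap, Fin.sum_univ_def]
  congr 2
  ext k
  rw [weightAfter]
  split_ifs <;> rfl

theorem total_batch (w : RCMessage L J → ℝ) (a : Fin L × Fin J → ℕ) :
    total w (sys.batch a) = ∑ l, ∑ j, (a (l, j) : ℝ) * w ⟨sys.serviceReq l, l, j⟩ := by
  simp [batch, total, List.flatMap, List.sum_flatten, Fin.sum_univ_def,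
    Function.comp_def]

theorem mean_step (ω : RCPolicy L J K) (α : RCState L J) (f : RCState L J → ℝ≥0∞) :
    Chain.mean (sys.step ω α) f = Chain.mean (ω.choose α) fun T =>
      Chain.mean sys.arrivalLaw fun a => f (sys.afterService α T ++ sys.batch a) := by
  rw [step, Chain.mean_bind]
  simp only [Chain.mean_map]

end Dynamics

/-! ### Moments of the arrivals -/

section Arrivals

theorem mean_arrivalLaw_eval (c : Fin L × Fin J) (f : ℕ → ℝ≥0∞) :
    Chain.mean sys.arrivalLaw (fun a => f (a c)) = Chain.mean (sys.arr c.1 c.2) f := by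
  have h1 : Chain.mean sys.arrivalLaw (fun a => f (a c)) = ∫⁻ a, f (a c)
      ∂(Measure.pi fun c : Fin L × Fin J => (sys.arr c.1 c.2).toMeasure) := by
    rw [lintegral_countable', Chain.mean]
    exact tsum_congr fun a => by rw [mul_comm, arrivalLaw, Measure.toPMF_apply]
  have h2 : Chain.mean (sys.arr c.1 c.2) f = ∫⁻ k, f k ∂(sys.arr c.1 c.2).toMeasure := by
    rw [lintegral_countable', Chain.mean]
    exact tsum_congr fun k => by
      rw [mul_comm, PMF.toMeasure_apply_singleton _ _ (MeasurableSet.singleton _)]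
  rw [h1, h2]
  exact (measurePreserving_eval (fun c : Fin L × Fin J => (sys.arr c.1 c.2).toMeasure)
    c).lintegral_comp (measurable_of_countable f)

/-- The second moment dominates the first, so the real series `meanArr` is a true mean and not a
default value. -/
theorem mean_arr (l : Fin L) (j : Fin J) :
    Chain.mean (sys.arr l j) (fun k => k) = ENNReal.ofReal (sys.meanArr l j) := by
  have hfin : Chain.mean (sys.arr l j) (fun k => k) ≠ ∞ := by
    refine ((ENNReal.tsum_le_tsum fun k => ?_).trans_lt (sys.secondMoment_finite l j)).ne
    rw [mul_comm]
    gcongr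
    rcases k.eq_zero_or_pos with rfl | hk
    · simp
    · exact le_self_pow₀ (Nat.one_le_cast.2 hk) two_ne_zero
  rw [← ENNReal.ofReal_toReal hfin, Chain.mean, ENNReal.tsum_toReal_eq]
  · congr 1
    exact tsum_congr fun k => by simp [mul_comm]
  · exact fun k => ENNReal.mul_ne_top (PMF.apply_ne_top _ _) (ENNReal.natCast_ne_top k)

/-- The sum of the weights `w` of the arriving messages. -/
def arrTotal (w : Fin L → Fin J → ℝ) (a : Fin L × Fin J → ℕ) : ℝ :=
  ∑ l, ∑ j, (a (l, j) : ℝ) * w l j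

theorem arrTotal_nonneg {w : Fin L → Fin J → ℝ} (hw : ∀ l j, 0 ≤ w l j)
    (a : Fin L × Fin J → ℕ) : 0 ≤ arrTotal w a :=
  Finset.sum_nonneg fun l _ => Finset.sum_nonneg fun j _ =>
    mul_nonneg (Nat.cast_nonneg _) (hw l j)

theorem meanArr_nonneg (l : Fin L) (j : Fin J) : 0 ≤ sys.meanArr l j :=
  tsum_nonneg fun _ => mul_nonneg (Nat.cast_nonneg _) ENNReal.toReal_nonneg

theorem mean_arrTotal {w : Fin L → Fin J → ℝ} (hw : ∀ l j, 0 ≤ w l j) :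
    Chain.mean sys.arrivalLaw (fun a => ENNReal.ofReal (arrTotal w a))
      = ENNReal.ofReal (∑ l, ∑ j, sys.meanArr l j * w l j) := by
  have h0 : ∀ (x : Fin L → Fin J → ℝ), (∀ l j, 0 ≤ x l j) →
      ENNReal.ofReal (∑ l, ∑ j, x l j * w l j)
        = ∑ l, ∑ j, ENNReal.ofReal (w l j) * ENNReal.ofReal (x l j) := by
    intro x hx
    rw [ENNReal.ofReal_sum_of_nonneg fun l _ =>
      Finset.sum_nonneg fun j _ => mul_nonneg (hx l j) (hw l j)]
    refine Finset.sum_congr rfl fun l _ => ?_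
    rw [ENNReal.ofReal_sum_of_nonneg fun j _ => mul_nonneg (hx l j) (hw l j)]
    exact Finset.sum_congr rfl fun j _ => by rw [ENNReal.ofReal_mul (hx l j), mul_comm]
  simp only [arrTotal]
  rw [h0 _ sys.meanArr_nonneg]
  simp only [fun a : Fin L × Fin J → ℕ => h0 (fun l j => (a (l, j) : ℝ))
    fun _ _ => Nat.cast_nonneg _, ENNReal.ofReal_natCast, Chain.mean_finset_sum,
    Chain.mean_const_mul]
  refine Finset.sum_congr rfl fun l _ => Finset.sum_congr rfl fun j _ => ?_
  rw [sys.mean_arrivalLaw_eval (l, j) (fun k => (k : ℝ≥0∞)), mean_arr]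

/-- Cauchy–Schwarz over the classes reduces this to the marginal second moments. -/
theorem mean_arrTotal_sq_ne_top (w : Fin L → Fin J → ℝ) :
    Chain.mean sys.arrivalLaw (fun a => ENNReal.ofReal (arrTotal w a ^ 2)) ≠ ∞ := by
  have hle : ∀ a : Fin L × Fin J → ℕ, ENNReal.ofReal (arrTotal w a ^ 2)
      ≤ ∑ c : Fin L × Fin J, ENNReal.ofReal ((Finset.univ : Finset (Fin L × Fin J)).card *
        w c.1 c.2 ^ 2) * (a c : ℝ≥0∞) ^ 2 := by
    intro a
    have h1 : arrTotal w a = ∑ c : Fin L × Fin J, (a c : ℝ) * w c.1 c.2 := by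
      rw [arrTotal, ← Fintype.sum_prod_type' (f := fun l j => (a (l, j) : ℝ) * w l j)]
    have h2 := sq_sum_le_card_mul_sum_sq (s := (Finset.univ : Finset (Fin L × Fin J)))
      (f := fun c => (a c : ℝ) * w c.1 c.2)
    rw [← h1, Finset.mul_sum] at h2
    refine (ENNReal.ofReal_le_ofReal h2).trans ?_
    rw [ENNReal.ofReal_sum_of_nonneg fun c _ => by positivity]
    refine Finset.sum_le_sum fun c _ => le_of_eq ?_
    rw [← ENNReal.ofReal_natCast (a c), ← ENNReal.ofReal_pow (Nat.cast_nonneg _),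
      ← ENNReal.ofReal_mul (by positivity)]
    congr 1
    ring
  refine ((Chain.mean_mono fun a _ => hle a).trans_lt ?_).ne
  rw [Chain.mean_finset_sum]
  refine ENNReal.sum_lt_top.2 fun c _ => ?_
  rw [Chain.mean_const_mul, sys.mean_arrivalLaw_eval c (fun k => (k : ℝ≥0∞) ^ 2)]
  refine ENNReal.mul_lt_top ENNReal.ofReal_lt_top ?_
  simpa only [Chain.mean, mul_comm] using sys.secondMoment_finite c.1 c.2

end Arrivals

end RCSystem

namespace RCSystem

variable {L J : ℕ} (sys : RCSystem L J)

theorem total_le {w : RCMessage L J → ℝ} {α : RCState L J} {B : ℝ} (h : ∀ m ∈ α, w m ≤ B) :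
    total w α ≤ α.length * B := by
  simpa [total] using List.sum_le_card_nsmul (α.map w) B (by simpa using h)

theorem le_total {w : RCMessage L J → ℝ} {α : RCState L J} {B : ℝ} (h : ∀ m ∈ α, B ≤ w m) :
    α.length * B ≤ total w α := by
  simpa [total] using List.card_nsmul_le_sum (α.map w) B (by simpa using h)

/-! ### Change of the work in one slot -/

section Work

variable {K : ℕ} {α : RCState L J} {T : Finset (Fin α.length)}

/-- With an allowance of `ε` per message for the service that the last quantum of a message wastes,
all of the service given counts if no quantum exceeds `ε`. -/
theorem total_afterService_le {ε : ℝ}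
    (hq : ∀ k ∈ T, sys.quantum (scheduleOf α T) (α.get k).pow ≤ ε)
    (hα : α ∈ sys.stateSpace K) :
    total (fun m => m.residual + ε) (sys.afterService α T)
      ≤ total (fun m => m.residual + ε) α
        - ∑ k ∈ T, sys.quantum (scheduleOf α T) (α.get k).pow := by
  classical
  have e : ∑ k ∈ T, sys.quantum (scheduleOf α T) (α.get k).pow
      = ∑ k, if k ∈ T then sys.quantum (scheduleOf α T) (α.get k).pow else 0 := by
    simp
  rw [total_afterService, total_eq_sum, e, ← Finset.sum_sub_distrib]
  refine Finset.sum_le_sum fun k _ => ?_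
  have hpos := IsResidual.pos (hα _ (List.get_mem α k))
  unfold weightAfter
  split_ifs with h1 h2
  -- A departing message gives up `residual + ε`, which covers its whole quantum since the quantum
  -- is at most `ε`.
  · linarith [hq k h1]
  · linarith
  · linarith

theorem total_afterService_le_total {ε : ℝ} (hε : 0 ≤ ε) (hα : α ∈ sys.stateSpace K) :
    total (fun m => m.residual + ε) (sys.afterService α T)
      ≤ total (fun m => m.residual + ε) α := by
  rw [total_afterService, total_eq_sum]
  refine Finset.sum_le_sum fun k _ => ?_
  have hpos := IsResidual.pos (hα _ (List.get_mem α k))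
  have hq := sys.quantum_nonneg (scheduleOf α T) (α.get k).pow
  unfold weightAfter
  split_ifs with h1 h2 <;> linarith

theorem total_afterService_nonneg {ε : ℝ} (hε : 0 ≤ ε) (hα : α ∈ sys.stateSpace K) :
    0 ≤ total (fun m => m.residual + ε) (sys.afterService α T) := by
  rw [total_afterService]
  refine Finset.sum_nonneg fun k _ => ?_
  have hpos := IsResidual.pos (hα _ (List.get_mem α k))
  unfold weightAfter
  split_ifs with h1 h2 <;> (try simp only) <;> linarith

variable (α T) in
-- A departing message loses only its residual, which is at most its quantum.
theorem le_total_afterService :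
    total RCMessage.residual α - ∑ k ∈ T, sys.quantum (scheduleOf α T) (α.get k).pow
      ≤ total RCMessage.residual (sys.afterService α T) := by
  classical
  have e : ∑ k ∈ T, sys.quantum (scheduleOf α T) (α.get k).pow
      = ∑ k, if k ∈ T then sys.quantum (scheduleOf α T) (α.get k).pow else 0 := by
    simp
  rw [total_afterService, total_eq_sum, e, ← Finset.sum_sub_distrib]
  refine Finset.sum_le_sum fun k _ => ?_
  unfold weightAfter
  split_ifs with h1 h2 <;> linarith

end Work

/-! ### Stability below the threshold -/

section Stability

theorem mean_sq_add_arrTotal {w : Fin L → Fin J → ℝ} (hw : ∀ l j, 0 ≤ w l j) {u : ℝ}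
    (hu : 0 ≤ u) :
    Chain.mean sys.arrivalLaw (fun a => ENNReal.ofReal ((u + arrTotal w a) ^ 2))
      = ENNReal.ofReal (u ^ 2 + 2 * u * (∑ l, ∑ j, sys.meanArr l j * w l j)
        + (Chain.mean sys.arrivalLaw fun a => ENNReal.ofReal (arrTotal w a ^ 2)).toReal) := by
  have hm : 0 ≤ ∑ l, ∑ j, sys.meanArr l j * w l j :=
    Finset.sum_nonneg fun l _ => Finset.sum_nonneg fun j _ =>
      mul_nonneg (sys.meanArr_nonneg l j) (hw l j)
  have h1 : ∀ a : Fin L × Fin J → ℕ, ENNReal.ofReal ((u + arrTotal w a) ^ 2)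
      = ENNReal.ofReal (u ^ 2) + ENNReal.ofReal (2 * u) * ENNReal.ofReal (arrTotal w a)
        + ENNReal.ofReal (arrTotal w a ^ 2) := by
    intro a
    have ha := arrTotal_nonneg hw a
    rw [← ENNReal.ofReal_mul (by positivity), ← ENNReal.ofReal_add (by positivity)
      (by positivity), ← ENNReal.ofReal_add (by positivity) (by positivity)]
    congr 1
    ring
  simp only [h1]
  rw [Chain.mean_add, Chain.mean_add, Chain.mean_const, Chain.mean_const_mul,
    sys.mean_arrTotal hw, ← ENNReal.ofReal_mul (by positivity),
    ← ENNReal.ofReal_add (by positivity) (by positivity),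
    ENNReal.ofReal_add (by positivity) ENNReal.toReal_nonneg,
    ENNReal.ofReal_toReal (sys.mean_arrTotal_sq_ne_top w)]

theorem positiveRecurrent_of_quantum_bounds {ε D : ℝ} (hε : 0 < ε)
    (hD : ∑ l, ∑ j, sys.meanArr l j * (sys.serviceReq l + ε) < D) {K : ℕ}
    (hK1 : ∀ (α : RCState L J) (T : Finset (Fin α.length)), T.card = K →
      D ≤ ∑ k ∈ T, sys.quantum (scheduleOf α T) (α.get k).pow)
    (hK2 : ∀ (α : RCState L J) (T : Finset (Fin α.length)), T.card = K →
      ∀ k ∈ T, sys.quantum (scheduleOf α T) (α.get k).pow ≤ ε) (ω : RCPolicy L J K) :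
    Chain.IsPositiveRecurrent (sys.step ω) (sys.stateSpace K) ∧
      (∃ π, Chain.IsStationary (sys.step ω) (sys.stateSpace K) π) ∧
      ∀ π, Chain.IsStationary (sys.step ω) (sys.stateSpace K) π →
        ∑' α, π α * (α.length : ℝ≥0∞) < ∞ := by
  obtain ⟨B, hB, hBS⟩ := sys.exists_serviceReq_le
  set w : RCMessage L J → ℝ := fun m => m.residual + ε with hw
  set V : RCState L J → ℝ := total w with hV
  have hS : ∀ (l : Fin L) (_ : Fin J), 0 ≤ sys.serviceReq l + ε := fun l _ =>
    (add_pos (sys.serviceReq_pos l) hε).le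
  set m := ∑ l, ∑ j, sys.meanArr l j * (sys.serviceReq l + ε) with hm
  have hm0 : 0 ≤ m := Finset.sum_nonneg fun l _ => Finset.sum_nonneg fun j _ =>
    mul_nonneg (sys.meanArr_nonneg l j) (hS l j)
  set s := (Chain.mean sys.arrivalLaw fun a =>
    ENNReal.ofReal (arrTotal (fun l _ => sys.serviceReq l + ε) a ^ 2)).toReal with hs
  have hs0 : 0 ≤ s := ENNReal.toReal_nonneg
  -- A bound on `V` when fewer than `K` messages are present.
  set R : ℝ := K * (B + ε) with hR
  have hR0 : 0 ≤ R := by positivity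
  -- `D ^ 2 + s` suffices with at least `K` messages, where `V` falls by at least `D` before the
  -- arrivals; the bracket together with `s` suffices otherwise.
  set b : ℝ := D ^ 2 + s + (R ^ 2 + 2 * R * m + 2 * (D - m) * R) with hb
  -- The drift gain is `2 * (D - m) * V`, and `V` is at least `ε` times the number of messages.
  set κ : ℝ≥0∞ := ENNReal.ofReal (2 * (D - m) * ε) with hκ
  have hκ0 : κ ≠ 0 := (ENNReal.ofReal_pos.2 (by have := sub_pos.2 hD; positivity)).ne'
  have hVlen : ∀ α ∈ sys.stateSpace K, α.length * ε ≤ V α := fun α hα =>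
    le_total fun m hmα => by
      have := IsResidual.pos (hα m hmα)
      simp only [hw]
      linarith
  have hdrift : ∀ α ∈ sys.stateSpace K,
      Chain.mean (sys.step ω α) (fun β => ENNReal.ofReal (V β ^ 2)) + κ * α.length
        ≤ ENNReal.ofReal (V α ^ 2) + ENNReal.ofReal b := by
    intro α hα
    have hV0 : 0 ≤ V α := le_trans (by positivity) (hVlen α hα)
    rw [sys.mean_step, ← Chain.mean_const (ω.choose α) (κ * α.length), ← Chain.mean_add,
      ← Chain.mean_const (ω.choose α) (ENNReal.ofReal (V α ^ 2) + ENNReal.ofReal b)]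
    refine Chain.mean_mono fun T hT => ?_
    have hcard := ω.nonIdling α T hT
    have hu0 : 0 ≤ V (sys.afterService α T) := sys.total_afterService_nonneg hε.le hα
    set u := V (sys.afterService α T) with hu
    have hnext : ∀ a, V (sys.afterService α T ++ sys.batch a)
        = u + arrTotal (fun l _ => sys.serviceReq l + ε) a := fun a => by
      rw [hV, total_append, total_batch, arrTotal, hu]
    have hgl : κ * α.length ≤ ENNReal.ofReal (2 * (D - m) * V α) := by
      rw [hκ, ← ENNReal.ofReal_natCast, ← ENNReal.ofReal_mul (by
        have := sub_pos.2 hD; positivity)]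
      refine ENNReal.ofReal_le_ofReal ?_
      have := mul_le_mul_of_nonneg_left (hVlen α hα) (show 0 ≤ 2 * (D - m) by linarith)
      linarith
    simp only [hnext]
    rw [sys.mean_sq_add_arrTotal hS hu0, ← hm, ← hs]
    refine (add_le_add le_rfl hgl).trans ?_
    have hDm : 0 ≤ D - m := by linarith
    have hD0 : 0 ≤ D := by linarith
    rw [← ENNReal.ofReal_add (by positivity) (by positivity),
      ← ENNReal.ofReal_add (by positivity) (by positivity)]
    refine ENNReal.ofReal_le_ofReal ?_
    rcases le_or_gt K α.length with hn | hn
    · have hTK : T.card = K := hcard.trans (min_eq_right hn)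
      have huV : u ≤ V α - D := (sys.total_afterService_le (hK2 α T hTK) hα).trans
        (sub_le_sub_left (hK1 α T hTK) _)
      have h1 : u ^ 2 ≤ (V α - D) ^ 2 := pow_le_pow_left₀ hu0 huV 2
      have h2 : u * m ≤ (V α - D) * m := mul_le_mul_of_nonneg_right huV hm0
      have h3 : 0 ≤ R ^ 2 + 2 * R * m + 2 * (D - m) * R := by positivity
      nlinarith [mul_nonneg hD0 hm0]
    · have hVR : V α ≤ R := by
        have h1 : V α ≤ α.length * (B + ε) := total_le fun x hx => by
          have := IsResidual.le (hα x hx)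
          simp only [hw]
          linarith [hBS x.req]
        refine h1.trans (mul_le_mul_of_nonneg_right ?_ (by positivity))
        exact_mod_cast hn.le
      have huR : u ≤ R := (sys.total_afterService_le_total hε.le hα).trans hVR
      have h1 : u ^ 2 ≤ R ^ 2 := pow_le_pow_left₀ hu0 huR 2
      have h2 : u * m ≤ R * m := mul_le_mul_of_nonneg_right huR hm0
      have h3 : (D - m) * V α ≤ (D - m) * R := mul_le_mul_of_nonneg_left hVR hDm
      nlinarith [sq_nonneg (V α), sq_nonneg D]
  obtain ⟨h1, h2, h3⟩ := Chain.positiveRecurrent_of_drift (sys.isClosedSet_stateSpace ω)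
    ⟨[], fun m hm => absurd hm List.not_mem_nil⟩ ENNReal.ofReal_ne_top
    (fun _ _ => ENNReal.ofReal_ne_top) hdrift (fun c hc => by
      obtain ⟨N, hN⟩ := ENNReal.exists_nat_gt (ENNReal.div_ne_top hc hκ0)
      refine (sys.finite_stateSpace_length_le K N).subset fun α hα => ⟨hα.1, ?_⟩
      have h : (α.length : ℝ≥0∞) ≤ c / κ := by
        rw [ENNReal.le_div_iff_mul_le (Or.inl hκ0) (Or.inl ENNReal.ofReal_ne_top), mul_comm]
        exact hα.2
      exact_mod_cast (h.trans_lt hN).le)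
  refine ⟨h1, h2, fun π hπ => ?_⟩
  have h4 := h3 π hπ
  rw [Chain.mean_const_mul] at h4
  exact ENNReal.lt_top_of_mul_ne_top_right (h4.trans_lt ENNReal.ofReal_lt_top).ne hκ0

end Stability

/-! ### Transience above the threshold -/

section Instability

/-- With `m` and `s` the first and second moments of the arriving work, the left side is at most `1
- θ m + θ² s`. If `θ s ≤ m - D` this is at most `1 - θ D`, hence at most `exp (-θ D)`. -/
theorem exists_mean_exp_le {w : Fin L → Fin J → ℝ} (hw : ∀ l j, 0 ≤ w l j) {D : ℝ}
    (hD : D < ∑ l, ∑ j, sys.meanArr l j * w l j) :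
    ∃ θ : ℝ, 0 < θ ∧ Chain.mean sys.arrivalLaw
      (fun a => ENNReal.ofReal (Real.exp (-(θ * arrTotal w a))))
        ≤ ENNReal.ofReal (Real.exp (-(θ * D))) := by
  set m := ∑ l, ∑ j, sys.meanArr l j * w l j with hm
  have hm0 : 0 ≤ m := Finset.sum_nonneg fun l _ => Finset.sum_nonneg fun j _ =>
    mul_nonneg (sys.meanArr_nonneg l j) (hw l j)
  set s := (Chain.mean sys.arrivalLaw fun a => ENNReal.ofReal (arrTotal w a ^ 2)).toReal with hs
  have hs0 : 0 ≤ s := ENNReal.toReal_nonneg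
  have hd := sub_pos.2 hD
  refine ⟨(m - D) / (s + 1), by positivity, ?_⟩
  set θ := (m - D) / (s + 1) with hθ
  have hθ0 : 0 < θ := by positivity
  have hθs : θ * s ≤ m - D := by
    have : θ * (s + 1) = m - D := div_mul_cancel₀ _ (by positivity)
    linarith
  have hexp : ∀ y : ℝ, 0 ≤ y → Real.exp (-y) + y ≤ 1 + y ^ 2 := by
    intro y hy
    have h1 : Real.exp (-y) ≤ (1 + y)⁻¹ := by
      rw [Real.exp_neg]
      exact inv_anti₀ (by positivity) (by linarith [Real.add_one_le_exp y])
    have h2 : (1 + y)⁻¹ ≤ 1 + y ^ 2 - y := by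
      rw [inv_le_iff_one_le_mul₀ (by positivity)]
      nlinarith [pow_nonneg hy 3]
    linarith
  -- The linear term stands on the left to avoid truncated subtraction inside the mean.
  have h1 : Chain.mean sys.arrivalLaw
      (fun a => ENNReal.ofReal (Real.exp (-(θ * arrTotal w a)))) + ENNReal.ofReal (θ * m)
      ≤ ENNReal.ofReal (1 + θ ^ 2 * s) := by
    rw [ENNReal.ofReal_mul hθ0.le, hm, ← sys.mean_arrTotal hw, ← Chain.mean_const_mul,
      ← Chain.mean_add, ENNReal.ofReal_add zero_le_one (by positivity),
      ENNReal.ofReal_mul (by positivity), hs,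
      ENNReal.ofReal_toReal (sys.mean_arrTotal_sq_ne_top w), ← Chain.mean_const_mul,
      ← Chain.mean_const sys.arrivalLaw (ENNReal.ofReal 1), ← Chain.mean_add]
    refine Chain.mean_mono fun a _ => ?_
    have ha := arrTotal_nonneg hw a
    rw [← ENNReal.ofReal_mul hθ0.le, ← ENNReal.ofReal_mul (by positivity),
      ← ENNReal.ofReal_add (by positivity) (by positivity),
      ← ENNReal.ofReal_add (by positivity) (by positivity)]
    refine ENNReal.ofReal_le_ofReal ((hexp _ (by positivity)).trans (le_of_eq ?_))
    ring
  have h2 := ENNReal.le_sub_of_add_le_right ENNReal.ofReal_ne_top h1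
  rw [← ENNReal.ofReal_sub _ (by positivity)] at h2
  refine h2.trans (ENNReal.ofReal_le_ofReal ?_)
  have h3 := Real.add_one_le_exp (-(θ * D))
  have h4 := mul_le_mul_of_nonneg_left hθs hθ0.le
  nlinarith

theorem isTransientState_of_quantum_bound {D : ℝ}
    (hD : D < ∑ l, ∑ j, sys.meanArr l j * sys.serviceReq l) {K : ℕ}
    (hK : ∀ (α : RCState L J) (T : Finset (Fin α.length)), T.card = K →
      ∑ k ∈ T, sys.quantum (scheduleOf α T) (α.get k).pow ≤ D) (ω : RCPolicy L J K)
    {α : RCState L J} (hα : α ∈ sys.stateSpace K)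
    (hinf : {β | Chain.Reaches (sys.step ω) α β}.Infinite) :
    Chain.IsTransientState (sys.step ω) α := by
  obtain ⟨B, hB, hBS⟩ := sys.exists_serviceReq_le
  have hS : ∀ (l : Fin L) (_ : Fin J), 0 ≤ sys.serviceReq l := fun l _ =>
    (sys.serviceReq_pos l).le
  obtain ⟨θ, hθ, hmean⟩ := sys.exists_mean_exp_le hS hD
  set U : RCState L J → ℝ := total RCMessage.residual with hU
  -- `R` bounds `U` at `α` and on all states with fewer than `K` messages, so that the test function
  -- `exp (θ (R - U))` is at least one there.
  set R : ℝ := max (K * B) (U α) with hR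
  have hclosed := sys.isClosedSet_stateSpace ω
  obtain ⟨r, hr, hres⟩ := sys.exists_residual_ge K
  obtain ⟨N, hN⟩ := exists_nat_gt (R / r)
  rw [div_lt_iff₀ hr] at hN
  -- Residuals are at least `r`, so a state with more than `N > R / r` messages has `U > R` and the
  -- test function is below one.
  obtain ⟨β, hβ, hβN⟩ : ∃ β, Chain.Reaches (sys.step ω) α β ∧ N < β.length := by
    by_contra! hcon
    exact hinf ((sys.finite_stateSpace_length_le K N).subset fun β hβ =>
      ⟨hclosed.reaches hα hβ, hcon β hβ⟩)
  have hone : ∀ γ, U γ ≤ R → 1 ≤ ENNReal.ofReal (Real.exp (θ * (R - U γ))) := fun γ hγ => by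
    rw [ENNReal.one_le_ofReal]
    exact Real.one_le_exp (mul_nonneg hθ.le (sub_nonneg.2 hγ))
  refine Chain.isTransientState_of_superharmonic (C := {γ | γ.length < K}) hclosed
    (f := fun γ => ENNReal.ofReal (Real.exp (θ * (R - U γ)))) (fun γ hγ hγK => ?_) hα
    (fun γ hγ => hone γ ?_) (hone α (le_max_right _ _)) hβ ?_
  · have hγK : K ≤ γ.length := not_lt.1 hγK
    rw [sys.mean_step, ← Chain.mean_const (ω.choose γ) (ENNReal.ofReal _)]
    refine Chain.mean_mono fun T hT => ?_
    have hTK : T.card = K := (ω.nonIdling γ T hT).trans (min_eq_right hγK)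
    have hle : U γ - D ≤ U (sys.afterService γ T) :=
      (sub_le_sub_left (hK γ T hTK) _).trans (sys.le_total_afterService γ T)
    calc Chain.mean sys.arrivalLaw (fun a => ENNReal.ofReal
          (Real.exp (θ * (R - U (sys.afterService γ T ++ sys.batch a)))))
        ≤ Chain.mean sys.arrivalLaw (fun a => ENNReal.ofReal (Real.exp (θ * (R - U γ + D))) *
            ENNReal.ofReal (Real.exp
              (-(θ * arrTotal (fun l _ => sys.serviceReq l) a)))) := by
          refine Chain.mean_mono fun a _ => ?_
          rw [← ENNReal.ofReal_mul (Real.exp_nonneg _), ← Real.exp_add, hU, total_append,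
            total_batch]
          refine ENNReal.ofReal_le_ofReal (Real.exp_le_exp.2 ?_)
          have := mul_le_mul_of_nonneg_left hle hθ.le
          simp only [arrTotal]
          linarith
      _ ≤ ENNReal.ofReal (Real.exp (θ * (R - U γ + D))) *
            ENNReal.ofReal (Real.exp (-(θ * D))) := by
          rw [Chain.mean_const_mul]
          gcongr
      _ = ENNReal.ofReal (Real.exp (θ * (R - U γ))) := by
          rw [← ENNReal.ofReal_mul (Real.exp_nonneg _), ← Real.exp_add]
          congr 2
          ring
  · have h1 : U γ ≤ γ.length * B := total_le fun m hm =>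
      (IsResidual.le (hγ.1 m hm)).trans (hBS _)
    refine h1.trans (le_trans ?_ (le_max_left _ _))
    exact mul_le_mul_of_nonneg_right (by exact_mod_cast (show γ.length < K from hγ.2).le) hB.le
  · have h1 : β.length * r ≤ U β :=
      le_total fun m hm => hres m (hclosed.reaches hα hβ m hm)
    have h2 : (N : ℝ) * r ≤ β.length * r :=
      mul_le_mul_of_nonneg_right (by exact_mod_cast hβN.le) hr.le
    rw [ENNReal.ofReal_lt_one, Real.exp_lt_one_iff]
    exact mul_neg_of_pos_of_neg hθ (by linarith)

end Instability

end RCSystem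

/-! ### The two regimes -/

theorem mainTheorem3 {L J : ℕ} (sys : RCSystem L J) :
    (∑ l, ∑ j, sys.meanArr l j * sys.serviceReq l < sys.rho / (1 + sys.rho) →
      ∀ᶠ K : ℕ in atTop, ∀ ω : RCPolicy L J K,
        Chain.IsPositiveRecurrent (sys.step ω) (sys.stateSpace K) ∧
        (∃ π, Chain.IsStationary (sys.step ω) (sys.stateSpace K) π) ∧
        ∀ π, Chain.IsStationary (sys.step ω) (sys.stateSpace K) π →
          ∑' α, π α * (α.length : ℝ≥0∞) < ∞) ∧
    (sys.rho / (1 + sys.rho) < ∑ l, ∑ j, sys.meanArr l j * sys.serviceReq l →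
      ∀ᶠ K : ℕ in atTop, ∀ ω : RCPolicy L J K, ∀ α ∈ sys.stateSpace K,
        {β | Chain.Reaches (sys.step ω) α β}.Infinite →
        Chain.IsTransientState (sys.step ω) α) := by
  refine ⟨fun h => ?_, fun h => ?_⟩
  · have hA : 0 ≤ ∑ l, ∑ j, sys.meanArr l j :=
      Finset.sum_nonneg fun l _ => Finset.sum_nonneg fun j _ => sys.meanArr_nonneg l j
    obtain ⟨D, hD1, hD2⟩ := exists_between h
    set A := ∑ l, ∑ j, sys.meanArr l j with hAdef
    set m := ∑ l, ∑ j, sys.meanArr l j * sys.serviceReq l with hm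
    -- The allowance adds `A * ε` to the mean arriving work `m`; this choice of `ε` keeps the sum
    -- below `D`, also when `A = 0`.
    have hε : 0 < (D - m) / (A + 1) := div_pos (sub_pos.2 hD1) (by positivity)
    have hlt : ∑ l, ∑ j, sys.meanArr l j * (sys.serviceReq l + (D - m) / (A + 1)) < D := by
      have e : ∑ l, ∑ j, sys.meanArr l j * (sys.serviceReq l + (D - m) / (A + 1))
          = m + A * ((D - m) / (A + 1)) := by
        simp only [mul_add, Finset.sum_add_distrib, hm, hAdef, Finset.sum_mul]
      have h1 : (A + 1) * ((D - m) / (A + 1)) = D - m := mul_div_cancel₀ _ (by positivity)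
      rw [e]
      linarith
    filter_upwards [sys.eventually_le_sum_quantum hD2, sys.eventually_quantum_le hε]
      with K h1 h2 ω
    exact sys.positiveRecurrent_of_quantum_bounds hε hlt h1 h2 ω
  · obtain ⟨D, hD1, hD2⟩ := exists_between h
    filter_upwards [sys.eventually_sum_quantum_le hD1] with K hK ω α hα hinf
    exact sys.isTransientState_of_quantum_bound hD2 hK ω hα hinf
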